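/- Let $\mathrm{A}(\mathbb{D})\subset \mathrm{C}(\overline{\mathbb{D}})$ be the disc algebra. A C*-cover of $\mathrm{A}(\mathbb{D})$ is a pair $(\mathcal{B},\iota)$ where $\mathcal{B}$ is a C*-algebra and $\iota:\mathrm{A}(\mathbb{D})\to\mathcal{B}$ is a completely isometric homomorphism with $\mathrm{C}^*(\iota(\mathrm{A}(\mathbb{D})))=\mathcal{B}$. Write $(\mathcal{B},\iota)\preceq(\mathcal{C},j)$ if there is a $*$-homomorphism $\pi:\mathcal{C}\to\mathcal{B}$ with $\pi j=\iota$. This preorder induces a partial order on the set $\text{C*-Lat}(\mathrm{A}(\mathbb{D}))$ of equivalence classes of C*-covers (two covers being equivalent if each is $\preceq$ the other), which is a complete lattice. A C*-cover is RFD if its C*-algebra embeds by an injective $*$-homomorphism into a product $\prod_\lambda M_{r_\lambda}$ of full matrix algebras over $\mathbb{C}$. Let $S$ be the unilateral shift on $\ell^2$ and, for $n\ge 1$, let $S_n\in M_n$ be the truncated shift, i.e. the matrix with ones on the first subdiagonal and zeros elsewhere. When $T$ is an element of a unital C*-algebra, $\mathrm{C}^*(T)$ is the unital C*-algebra generated by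 $T$, regarded as a C*-cover through the embedding with $z\mapsto T$ whenever this embedding exists and is completely isometric. Here $\bigoplus_{n\in X}S_n$ is viewed in $\prod_{n\in X}M_n$ (bounded families). Then: (1) $\mathrm{C}^*\big(\bigoplus_{n\ge 1,\ n\text{ even}}S_n\big)$ and $\mathrm{C}^*\big(\bigoplus_{n\ge 1,\ n\text{ odd}}S_n\big)$ are RFD C*-covers of $\mathrm{A}(\mathbb{D})$, and their meet in $\text{C*-Lat}(\mathrm{A}(\mathbb{D}))$ is $\mathrm{C}^*(S\oplus S^*)$, which is not RFD. (2) The C*-algebras $\mathrm{C}^*\big(\bigoplus_{n\ge k}S_n\big)$, $k\ge 1$, are RFD C*-covers of $\mathrm{A}(\mathbb{D})$ which form a strictly decreasing chain in $\text{C*-Lat}(\mathrm{A}(\mathbb{D}))$, and the meet of this chain in $\text{C*-Lat}(\mathrm{A}(\mathbb{D}))$ is not RFD. In particular, the set of RFD C*-covers is not closed under the binary lattice operations of $\text{C*-Lat}(\mathrm{A}(\mathbb{D}))$, that is, it is not a sublattice. -/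

import Mathlib

open scoped ENNReal Matrix.Norms.L2Operator

noncomputable section

universe u v

/-! ### Operator algebras, complete isometries and C*-covers -/

/-- The norm of an `n × n` matrix over a C*-algebra `E`, i.e. the norm of the C*-algebra `M_n(E)`.
(Mathlib's norm on `CStarMatrix` asks for a star-order on `E`; we use the canonical one.) -/
def matNorm {E : Type u} [NonUnitalCStarAlgebra E] {n : ℕ} (a : Matrix (Fin n) (Fin n) E) : ℝ :=
  letI : PartialOrder E := CStarAlgebra.spectralOrder E
  haveI : StarOrderedRing E := CStarAlgebra.spectralOrderedRing E
  ‖CStarMatrix.ofMatrix a‖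

/-- A (concrete) operator algebra is a subalgebra `A` of a C*-algebra `E`, with the matrix norms
inherited from `E`. A homomorphism from `A` into a C*-algebra is completely isometric if it
preserves the norms of all square matrices over `A`. -/
def IsCompletelyIsometric {E : Type v} [NonUnitalCStarAlgebra E] {A : NonUnitalSubalgebra ℂ E}
    {B : Type u} [NonUnitalCStarAlgebra B] (ι : A →ₙₐ[ℂ] B) : Prop :=
  ∀ (n : ℕ) (a : Matrix (Fin n) (Fin n) A),
    matNorm (a.map fun x => ι x) = matNorm (a.map fun x => (x : E))

/-- A C*-cover `(B, ι)` of an operator algebra `A`: a C*-algebra `B` with a completely isometric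
homomorphism `ι : A → B` whose range generates `B` as a C*-algebra. -/
structure CStarCover {E : Type v} [NonUnitalCStarAlgebra E] (A : NonUnitalSubalgebra ℂ E) where
  /-- the C*-algebra -/
  alg : Type u
  /-- its structure -/
  [inst : NonUnitalCStarAlgebra alg]
  /-- the embedding -/
  ι : A →ₙₐ[ℂ] alg
  completelyIsometric : IsCompletelyIsometric ι
  generates : (NonUnitalStarAlgebra.adjoin ℂ (Set.range ι)).topologicalClosure = ⊤

attribute [instance] CStarCover.inst

section Lattice

variable {E : Type v} [NonUnitalCStarAlgebra E] {A : NonUnitalSubalgebra ℂ E}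

/-- `(B, ι) ≼ (C, j)` iff there is a morphism `π : (C, j) → (B, ι)`, that is, a *-homomorphism
`π : C → B` with `π j = ι`. -/
instance CStarCover.instPreorder : Preorder (CStarCover.{u} A) where
  le B C := ∃ π : C.alg →⋆ₙₐ[ℂ] B.alg, ∀ a, π (C.ι a) = B.ι a
  le_refl B := ⟨NonUnitalStarAlgHom.id ℂ B.alg, fun _ => rfl⟩
  le_trans B C D := by
    rintro ⟨π, hπ⟩ ⟨σ, hσ⟩
    exact ⟨π.comp σ, fun a => by simp [hσ, hπ]⟩

variable (A) in
/-- The partially ordered set of equivalence classes of C*-covers of `A`; two covers are equivalent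
if there are morphisms in both directions. -/
abbrev CStarLat : Type (max v (u + 1)) := Antisymmetrization (CStarCover.{u} A) (· ≤ ·)

/-- The equivalence class of a C*-cover. -/
def CStarCover.cls (B : CStarCover.{u} A) : CStarLat.{u} A := toAntisymmetrization (· ≤ ·) B

end Lattice

/-- A C*-algebra is residually finite-dimensional if it embeds in a product (of bounded families)
`∏_λ M_{r_λ}` of full matrix algebras over `ℂ`. -/
def IsRFD (B : Type u) [NonUnitalCStarAlgebra B] : Prop :=
  ∃ (Λ : Type u) (r : Λ → ℕ+)
    (π : B →⋆ₙₐ[ℂ] lp (fun l => Matrix (Fin (r l)) (Fin (r l)) ℂ) ∞), Function.Injective π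

/-- The set of (classes of) residually finite-dimensional C*-covers of `A`. -/
def rfdCovers {E : Type v} [NonUnitalCStarAlgebra E] (A : NonUnitalSubalgebra ℂ E) :
    Set (CStarLat.{u} A) :=
  {x | ∃ B : CStarCover.{u} A, IsRFD B.alg ∧ B.cls = x}

/-- A subset `s` of a partially ordered set `P` is closed under the binary lattice operations
of `P`: if two elements of `s` have a meet, respectively a join, in `P`, then it lies in `s`. For a
lattice `P` this says that `s` is a sublattice. -/
def IsSublatticeIn {P : Type u} [PartialOrder P] (s : Set P) : Prop :=
  ∀ a ∈ s, ∀ b ∈ s, (∀ m, IsGLB {a, b} m → m ∈ s) ∧ (∀ j, IsLUB {a, b} j → j ∈ s)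

/-! ### The disc algebra -/

/-- The disc algebra `A(𝔻)`: the continuous functions on the closed unit disc that are holomorphic
in the open unit disc, as a subalgebra of the C*-algebra of continuous functions. -/
def discAlgebra : NonUnitalSubalgebra ℂ C(Metric.closedBall (0 : ℂ) 1, ℂ) where
  carrier := {f | ∃ g : ℂ → ℂ, DifferentiableOn ℂ g (Metric.ball 0 1) ∧
    ∀ z : Metric.closedBall (0 : ℂ) 1, g z = f z}
  add_mem' := by
    rintro _ _ ⟨g, hg, h⟩ ⟨g', hg', h'⟩
    exact ⟨g + g', hg.add hg', fun z => by simp [h, h']⟩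
  zero_mem' := ⟨0, differentiableOn_const 0, fun z => by simp⟩
  mul_mem' := by
    rintro _ _ ⟨g, hg, h⟩ ⟨g', hg', h'⟩
    exact ⟨g * g', hg.mul hg', fun z => by simp [h, h']⟩
  smul_mem' := by
    rintro c _ ⟨g, hg, h⟩
    exact ⟨c • g, hg.const_smul c, fun z => by simp [h]⟩

/-- The coordinate function `z`, which generates the disc algebra. -/
def discZ : discAlgebra :=
  ⟨⟨fun z => (z : ℂ), continuous_subtype_val⟩, ⟨id, differentiableOn_id, fun _ => rfl⟩⟩

/-- For an element `T` of a unital C*-algebra: the C*-cover `(B, ι)` of the disc algebra is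
`C*(T)`, the unital C*-algebra generated by `T`, with the embedding that sends `z` to `T` (such an
embedding is unique, since the polynomials are dense in the disc algebra). -/
def IsCoverOf (B : CStarCover.{u} discAlgebra) {D : Type v} [CStarAlgebra D] (T : D) : Prop :=
  ∃ φ : B.alg ≃⋆ₐ[ℂ] StarAlgebra.elemental ℂ T, (φ (B.ι discZ) : D) = T

/-! ### Shifts -/

/-- The Hilbert space `ℓ²`, with orthonormal basis indexed by `0, 1, 2, …`. -/
abbrev EllTwo : Type := lp (fun _ : ℕ => ℂ) 2

/-- The sequence `(0, x₀, x₁, …)`. -/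
def shiftSeq (x : ℕ → ℂ) : ℕ → ℂ
  | 0 => 0
  | n + 1 => x n

theorem hasSum_shiftSeq (x : EllTwo) :
    HasSum (fun n => ‖shiftSeq x n‖ ^ (2 : ℝ≥0∞).toReal) (‖x‖ ^ (2 : ℝ≥0∞).toReal) := by
  rw [← hasSum_nat_add_iff' 1]
  simpa [shiftSeq] using lp.hasSum_norm (p := 2) (by norm_num) x

/-- The unilateral shift `S` on `ℓ²`: `S (x₀, x₁, …) = (0, x₀, x₁, …)`. -/
def unilateralShift : EllTwo →L[ℂ] EllTwo :=
  LinearMap.mkContinuous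
    { toFun := fun x => ⟨shiftSeq x, memℓp_gen (hasSum_shiftSeq x).summable⟩
      map_add' := fun x y => by
        ext n
        cases n with
        | zero => exact (add_zero (0 : ℂ)).symm
        | succ n => rfl
      map_smul' := fun c x => by
        ext n
        cases n <;> simp [shiftSeq] }
    1 fun x => by
      rw [one_mul]
      refine lp.norm_le_of_tsum_le (by norm_num) (norm_nonneg _) ?_
      exact (hasSum_shiftSeq x).tsum_eq.le

/-- `S ⊕ S*` on the Hilbert space direct sum `ℓ² ⊕ ℓ²`. -/
def shiftSumAdjoint : WithLp 2 (EllTwo × EllTwo) →L[ℂ] WithLp 2 (EllTwo × EllTwo) :=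
  ((WithLp.prodContinuousLinearEquiv 2 ℂ EllTwo EllTwo).symm :
      EllTwo × EllTwo →L[ℂ] WithLp 2 (EllTwo × EllTwo)) ∘L
    (unilateralShift.prodMap (ContinuousLinearMap.adjoint unilateralShift)) ∘L
    (WithLp.prodContinuousLinearEquiv 2 ℂ EllTwo EllTwo :
      WithLp 2 (EllTwo × EllTwo) →L[ℂ] EllTwo × EllTwo)

/-- The truncated shift `S_n`, the `n × n` matrix with ones on the first subdiagonal and zeros
elsewhere. -/
def truncShift (n : ℕ) : Matrix (Fin n) (Fin n) ℂ :=
  Matrix.of fun i j => if (i : ℕ) = j + 1 then 1 else 0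

theorem norm_truncShift_le (n : ℕ) : ‖truncShift n‖ ≤ 1 := by
  have h : (truncShift n).conjTranspose * truncShift n =
      Matrix.diagonal fun i : Fin n => if (i : ℕ) + 1 < n then (1 : ℂ) else 0 := by
    ext i j
    rw [Matrix.mul_apply, Matrix.diagonal_apply]
    by_cases hi : (i : ℕ) + 1 < n
    · rw [Finset.sum_eq_single (⟨i + 1, hi⟩ : Fin n)]
      · simp [truncShift, hi, Fin.ext_iff]
      · intro k _ hk
        have hk' : (k : ℕ) ≠ i + 1 := fun e => hk (Fin.ext e)
        simp [truncShift, hk']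
      · simp
    · rw [Finset.sum_eq_zero]
      · simp [hi]
      · intro k _
        have hk' : (k : ℕ) ≠ i + 1 := fun e => hi (e ▸ k.2)
        simp [truncShift, hk']
  have h2 : ‖truncShift n‖ * ‖truncShift n‖ ≤ 1 := by
    rw [← Matrix.l2_opNorm_conjTranspose_mul_self, h, Matrix.l2_opNorm_diagonal,
      pi_norm_le_iff_of_nonneg zero_le_one]
    intro i
    split_ifs <;> simp
  nlinarith [norm_nonneg (truncShift n)]

/-- The unital C*-algebra structure of the product of a family of nonzero unital C*-algebras. -/
instance lpInftyCStarAlgebra {I : Type u} {B : I → Type v} [∀ i, Nontrivial (B i)]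
    [∀ i, CStarAlgebra (B i)] : CStarAlgebra (lp B ∞) where

/-- The product `∏_{n ∈ X} M_n` (bounded families), for a set `X` of positive integers. -/
abbrev MatProd (X : Set ℕ+) : Type :=
  lp (fun n : X => Matrix (Fin (n : ℕ+)) (Fin (n : ℕ+)) ℂ) ∞

/-- The element `⊕_{n ∈ X} S_n` of `∏_{n ∈ X} M_n`. -/
def truncShiftSum (X : Set ℕ+) : MatProd X :=
  ⟨fun n => truncShift (n : ℕ+), memℓp_infty ⟨1, by
    rintro _ ⟨n, rfl⟩
    exact norm_truncShift_le _⟩⟩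

end

/-! The first basis vectors of `ℂⁿ` see `S_n` as a forward shift; the last ones, read backwards, see
it as a backward shift. So for large `n` the matrix `S_n` resembles `S ⊕ S*`. The maps `blend n : ℓ²
⊕ ℓ² → ℂⁿ` make this precise: they mix coordinate `i` of the first summand with coordinate `n - 1 -
i` of the second, using the weights `√(1 - i/n)` and `√(i/n)`. The squares of the weights add up to
`1`, so `blend n` is a coisometry. On each fixed vector it is asymptotically isometric. Neighbouring
weights differ by at most `n^{-1/2}`, so `S ⊕ S*` and `S_n`, and likewise their adjoints, are
intertwined up to `2 n^{-1/2}`. Hence, for infinite `X`, there is a *-homomorphism `C*(⊕_{n ∈ X}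
S_n) → C*(S ⊕ S*)` under which the norm of an image bounds the coordinates of the element up to any
`ε`, with finitely many exceptions (`exists_shiftHom`). Every homomorphism dominated by the
coordinates at infinity therefore factors through `C*(S ⊕ S*)` (`exists_factor_shiftHom`).

These algebras are covers for the following reason. Compressing cyclic permutation matrices gives
the von Neumann inequality for matrices of polynomials in `S_n`. Conversely, approximate
eigenvectors of `S_n` give characters at every point of the circle, and the maximum modulus
principle does the rest.

The meets are computed with `g_k = (1 - T T*) T*ᵏ (1 - T* T)`, which is nonzero at `S_n` exactly
when `n = k + 1`. If `n ∉ X`, then `g_{n-1}` vanishes in `C*(⊕_{m ∈ X} S_m)` and in every cover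
below it. If every `n` is missing from some `X j`, a common lower bound thus kills all the `g_k`.
These generate the units of the individual blocks, so the lower bound is dominated by the
coordinates at infinity and lies below `C*(S ⊕ S*)` (`le_shiftCover`, `isGLB_truncCover`). Evens and
odds, and likewise all the tails, are such families. The same elements make the chain strict.

Finally, `C*(S ⊕ S*)` is not RFD: for `T = S ⊕ S*` and `E = 1 - T T*` the elements `Tᵇ E` are
partial isometries with orthogonal ranges, so every finite-dimensional representation kills `E ≠ 0`.
-/

noncomputable section

/-! ### Extension of homomorphisms by density -/

section Extension

variable {R A B : Type*} [NonUnitalNormedRing A] [NormedSpace ℂ A]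
  [NonUnitalNormedRing B] [NormedSpace ℂ B] [CompleteSpace B]

/-- A homomorphism `π` that is dominated in norm by a homomorphism `σ` with dense range factors
through `σ`. -/
theorem exists_nonUnitalAlgHom_of_norm_le [NonUnitalNonAssocRing R] [Module ℂ R]
    (σ : R →ₙₐ[ℂ] A) (π : R →ₙₐ[ℂ] B) (hσ : DenseRange σ) (h : ∀ x, ‖π x‖ ≤ ‖σ x‖) :
    ∃ φ : A →ₙₐ[ℂ] B, Continuous φ ∧ (∀ a, ‖φ a‖ ≤ ‖a‖) ∧ ∀ x, φ (σ x) = π x := by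
  set f : R →ₗ[ℂ] B := (π : R →ₗ[ℂ] B) with hf
  set e : R →ₗ[ℂ] A := (σ : R →ₗ[ℂ] A) with he
  have hd : DenseRange e := hσ
  have hb : ∀ x, ‖f x‖ ≤ 1 * ‖e x‖ := fun x => by simpa [hf, he] using h x
  have heq : ∀ x, f.extendOfNorm e (σ x) = π x := fun x =>
    LinearMap.extendOfNorm_eq hd ⟨1, hb⟩ x
  have hmul : ∀ a b, f.extendOfNorm e (a * b) = f.extendOfNorm e a * f.extendOfNorm e b := by
    intro a b
    refine hσ.induction_on₂ (p := fun a b => f.extendOfNorm e (a * b) =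
      f.extendOfNorm e a * f.extendOfNorm e b) ?_ ?_ a b
    · exact isClosed_eq (by fun_prop) (by fun_prop)
    · intro x y
      rw [← map_mul, heq, heq, heq, map_mul]
  refine ⟨{ toFun := f.extendOfNorm e, map_smul' := fun c x => by simp, map_zero' := by simp,
            map_add' := fun x y => by simp, map_mul' := hmul },
    (f.extendOfNorm e).continuous, fun a => ?_, heq⟩
  simpa using LinearMap.norm_extendOfNorm_apply_le hd 1 hb a

theorem exists_nonUnitalStarAlgHom_of_norm_le [NonUnitalNonAssocRing R] [Module ℂ R] [Star R]
    [StarRing A] [ContinuousStar A] [StarRing B] [ContinuousStar B]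
    (σ : R →⋆ₙₐ[ℂ] A) (π : R →⋆ₙₐ[ℂ] B) (hσ : DenseRange σ) (h : ∀ x, ‖π x‖ ≤ ‖σ x‖) :
    ∃ φ : A →⋆ₙₐ[ℂ] B, ∀ x, φ (σ x) = π x := by
  obtain ⟨φ, hφ, -, hx⟩ := exists_nonUnitalAlgHom_of_norm_le
    (σ : R →ₙₐ[ℂ] A) (π : R →ₙₐ[ℂ] B) hσ h
  refine ⟨{ φ with map_star' := fun a => ?_ }, hx⟩
  refine hσ.induction_on (p := fun a => φ (star a) = star (φ a)) a
    (isClosed_eq (by fun_prop) (by fun_prop)) fun x => ?_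
  have h1 : φ (σ x) = π x := hx x
  have h2 : φ (σ (star x)) = π (star x) := hx (star x)
  rw [h1, ← map_star, ← map_star, h2]

end Extension

/-! ### Matrix norms -/

/-- The joint kernel of a family of *-homomorphisms controls the norm. -/
theorem norm_le_of_forall_starHom {A : Type*} [NonUnitalCStarAlgebra A] {I : Type*}
    {B : I → Type*} [∀ i, NonUnitalCStarAlgebra (B i)] (φ : ∀ i, A →⋆ₙₐ[ℂ] B i)
    (hφ : ∀ a, (∀ i, φ i a = 0) → a = 0) {a : A} {c : ℝ} (hc : 0 ≤ c)
    (h : ∀ i, ‖φ i a‖ ≤ c) : ‖a‖ ≤ c := by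
  let Φ : A →⋆ₙₐ[ℂ] lp B ∞ :=
    { toFun := fun x => ⟨fun i => φ i x, memℓp_infty ⟨‖x‖, by
        rintro _ ⟨i, rfl⟩
        exact NonUnitalStarAlgHom.norm_apply_le (φ i) x⟩⟩
      map_smul' := fun c x => by ext i; simp
      map_zero' := by ext i; simp
      map_add' := fun x y => by ext i; exact map_add (φ i) x y
      map_mul' := fun x y => by ext i; simp [lp.infty_coeFn_mul]
      map_star' := fun x => by ext i; exact map_star (φ i) x }
  have hΦ : Function.Injective Φ := by
    rw [injective_iff_map_eq_zero]
    intro x hx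
    refine hφ x fun i => ?_
    exact congrFun (congrArg (fun y : lp B ∞ => (y : ∀ i, B i)) hx) i
  rw [← NonUnitalStarAlgHom.norm_map Φ hΦ a]
  exact lp.norm_le_of_forall_le hc h

section MatNorm

variable {A : Type*} {B : Type*} [NonUnitalCStarAlgebra A] [NonUnitalCStarAlgebra B] {n : ℕ}

theorem matNorm_nonneg (a : Matrix (Fin n) (Fin n) A) : 0 ≤ matNorm a := by
  let : PartialOrder A := CStarAlgebra.spectralOrder A
  have : StarOrderedRing A := CStarAlgebra.spectralOrderedRing A
  exact norm_nonneg (CStarMatrix.ofMatrix a)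

theorem matNorm_map_le (φ : A →⋆ₙₐ[ℂ] B) (a : Matrix (Fin n) (Fin n) A) :
    matNorm (a.map φ) ≤ matNorm a := by
  let : PartialOrder A := CStarAlgebra.spectralOrder A
  have : StarOrderedRing A := CStarAlgebra.spectralOrderedRing A
  let : PartialOrder B := CStarAlgebra.spectralOrder B
  have : StarOrderedRing B := CStarAlgebra.spectralOrderedRing B
  exact NonUnitalStarAlgHom.norm_apply_le (CStarMatrix.mapₙₐ φ) (CStarMatrix.ofMatrix a)

theorem matNorm_map_of_injective (φ : A →⋆ₙₐ[ℂ] B) (hφ : Function.Injective φ)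
    (a : Matrix (Fin n) (Fin n) A) : matNorm (a.map φ) = matNorm a := by
  let : PartialOrder A := CStarAlgebra.spectralOrder A
  have : StarOrderedRing A := CStarAlgebra.spectralOrderedRing A
  let : PartialOrder B := CStarAlgebra.spectralOrder B
  have : StarOrderedRing B := CStarAlgebra.spectralOrderedRing B
  exact NonUnitalStarAlgHom.norm_map (CStarMatrix.mapₙₐ φ) (CStarMatrix.map_injective hφ)
    (CStarMatrix.ofMatrix a)

theorem matNorm_le_of_forall {I : Type*} {C : I → Type*} [∀ i, NonUnitalCStarAlgebra (C i)]
    (φ : ∀ i, A →⋆ₙₐ[ℂ] C i) (hφ : ∀ a, (∀ i, φ i a = 0) → a = 0)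
    {a : Matrix (Fin n) (Fin n) A} {c : ℝ} (hc : 0 ≤ c) (h : ∀ i, matNorm (a.map (φ i)) ≤ c) :
    matNorm a ≤ c := by
  let : PartialOrder A := CStarAlgebra.spectralOrder A
  have : StarOrderedRing A := CStarAlgebra.spectralOrderedRing A
  let (i : I) : PartialOrder (C i) := CStarAlgebra.spectralOrder (C i)
  have (i : I) : StarOrderedRing (C i) := CStarAlgebra.spectralOrderedRing (C i)
  refine norm_le_of_forall_starHom
    (fun i => (CStarMatrix.mapₙₐ (φ i) : CStarMatrix (Fin n) (Fin n) A →⋆ₙₐ[ℂ] _))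
    (fun x hx => ?_) hc h
  ext i j
  exact hφ _ fun k => congrFun (congrFun (hx k) i) j

theorem continuous_matNorm :
    Continuous (matNorm : Matrix (Fin n) (Fin n) A → ℝ) := by
  let : PartialOrder A := CStarAlgebra.spectralOrder A
  have : StarOrderedRing A := CStarAlgebra.spectralOrderedRing A
  exact continuous_norm.comp CStarMatrix.uniformEmbedding_ofMatrix.isEmbedding.continuous

theorem norm_eq_matNorm_fin_one (x : A) :
    matNorm (Matrix.of fun _ _ : Fin 1 => x) = ‖x‖ := by
  let : PartialOrder A := CStarAlgebra.spectralOrder A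
  have : StarOrderedRing A := CStarAlgebra.spectralOrderedRing A
  let φ : A →⋆ₙₐ[ℂ] CStarMatrix (Fin 1) (Fin 1) A :=
    { toFun := fun x => CStarMatrix.ofMatrix (Matrix.of fun _ _ => x)
      map_smul' := fun c x => rfl
      map_zero' := rfl
      map_add' := fun x y => rfl
      map_mul' := fun x y => by ext i j; simp [CStarMatrix.mul_apply]
      map_star' := fun x => rfl }
  have hφ : Function.Injective φ := fun x y h => congrFun (congrFun h 0) 0
  exact NonUnitalStarAlgHom.norm_map φ hφ x

/-- Entrywise compression by `p` is compression by the projection `diag(p, …, p)`, which has norm at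
most `1`. -/
theorem matNorm_compress_le {A : Type*} [CStarAlgebra A] {p : A} (hp : IsStarProjection p)
    (a : Matrix (Fin n) (Fin n) A) : matNorm (a.map fun x => p * x * p) ≤ matNorm a := by
  let : PartialOrder A := CStarAlgebra.spectralOrder A
  have : StarOrderedRing A := CStarAlgebra.spectralOrderedRing A
  let D : CStarMatrix (Fin n) (Fin n) A := CStarMatrix.ofMatrix (Matrix.diagonal fun _ => p)
  have hD : IsStarProjection D := by
    constructor
    · ext i j
      have := hp.isIdempotentElem.eq
      by_cases h : i = j <;>
        simp [D, CStarMatrix.mul_apply, Matrix.diagonal_apply, h, this]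
    · ext i j
      have := hp.isSelfAdjoint.star_eq
      by_cases h : i = j
      · simp [D, CStarMatrix.star_apply, h, this]
      · simp [D, CStarMatrix.star_apply, h, Ne.symm h]
  have hD1 : ‖D‖ ≤ 1 := hD.norm_le
  have h : CStarMatrix.ofMatrix (a.map fun x => p * x * p) = D * CStarMatrix.ofMatrix a * D := by
    ext i j
    simp [D, CStarMatrix.mul_apply, Matrix.diagonal_apply]
  change ‖CStarMatrix.ofMatrix (a.map fun x => p * x * p)‖ ≤ ‖CStarMatrix.ofMatrix a‖
  rw [h]
  calc ‖D * CStarMatrix.ofMatrix a * D‖ ≤ ‖D‖ * ‖CStarMatrix.ofMatrix a‖ * ‖D‖ :=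
        (norm_mul_le _ _).trans (by gcongr; exact norm_mul_le _ _)
    _ ≤ 1 * ‖CStarMatrix.ofMatrix a‖ * 1 := by gcongr
    _ = _ := by ring

end MatNorm

/-- The elements of the C*-algebra generated by `(T, T')`. -/
def jointGen {D D' : Type*} [CStarAlgebra D] [CStarAlgebra D'] (T : D) (T' : D') : Set (D × D') :=
  StarAlgebra.elemental ℂ (T, T')

/-! ### Asymptotic intertwining -/

section Asymptotic

open Filter Topology

variable {D : Type*} [CStarAlgebra D] {I : Type*} {H : Type*} [NormedAddCommGroup H]
  [InnerProductSpace ℂ H] {K : I → Type*} [∀ i, NormedAddCommGroup (K i)]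
  [∀ i, InnerProductSpace ℂ (K i)] [∀ i, CompleteSpace (K i)]

/-- The operators `G i : H → K i` asymptotically intertwine `y.2` with the images of `y.1`. -/
def AsympIntertwines (l : Filter I) (G : ∀ i, H →L[ℂ] K i) (ρ : ∀ i, D →⋆ₐ[ℂ] (K i →L[ℂ] K i))
    (y : D × (H →L[ℂ] H)) : Prop :=
  Tendsto (fun i => ‖G i ∘L y.2 - ρ i y.1 ∘L G i‖) l (𝓝 0)

variable {l : Filter I} {G : ∀ i, H →L[ℂ] K i} {ρ : ∀ i, D →⋆ₐ[ℂ] (K i →L[ℂ] K i)}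

/-- The asymptotically intertwined pairs form a norm-closed unital algebra; for products, insert
`ρ(u) G v`. Taking adjoints would turn `G` into `G*`, so the pair of adjoints is a separate
hypothesis. -/
theorem AsympIntertwines.of_mem_jointGen [CompleteSpace H] (hG : ∀ i, ‖G i‖ ≤ 1) {T : D} {b : H →L[ℂ] H}
    (h : AsympIntertwines l G ρ (T, b)) (h' : AsympIntertwines l G ρ (star T, star b))
    {y : D × (H →L[ℂ] H)} (hy : y ∈ jointGen T b) :
    AsympIntertwines l G ρ y := by
  have hρ : ∀ i x, ‖ρ i x‖ ≤ ‖x‖ := fun i x => NonUnitalStarAlgHom.norm_apply_le (ρ i) x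
  replace hy : y ∈ StarAlgebra.elemental ℂ (T, b) := hy
  induction hy using StarAlgebra.elemental.induction_on with
  | self => exact h
  | star_self => exact h'
  | algebraMap r =>
    refine Tendsto.congr (fun i => ?_) tendsto_const_nhds
    have : G i ∘L (algebraMap ℂ (D × (H →L[ℂ] H)) r).2 -
        ρ i (algebraMap ℂ (D × (H →L[ℂ] H)) r).1 ∘L G i = 0 := by
      ext v
      simp [Algebra.algebraMap_eq_smul_one]
    rw [this, norm_zero]
  | add u hu v hv h1 h2 =>
    have := Tendsto.add h1 h2
    rw [add_zero] at this
    refine squeeze_zero (fun _ => norm_nonneg _) (fun i => ?_) this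
    refine le_trans (le_of_eq ?_) (norm_add_le _ _)
    congr 1
    ext w
    simp only [Prod.snd_add, Prod.fst_add, map_add, add_apply,
      sub_apply, ContinuousLinearMap.comp_apply]
    abel
  | mul u hu v hv h1 h2 =>
    have := Tendsto.add (Tendsto.mul_const ‖v.2‖ h1) (Tendsto.const_mul ‖u.1‖ h2)
    rw [zero_mul, mul_zero, add_zero] at this
    refine squeeze_zero (fun _ => norm_nonneg _) (fun i => ?_) this
    have e : G i ∘L (u * v).2 - ρ i (u * v).1 ∘L G i =
        (G i ∘L u.2 - ρ i u.1 ∘L G i) ∘L v.2 + ρ i u.1 ∘L (G i ∘L v.2 - ρ i v.1 ∘L G i) := by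
      ext w
      simp [map_mul]
    rw [e]
    refine (norm_add_le _ _).trans (add_le_add (ContinuousLinearMap.opNorm_comp_le _ _) ?_)
    refine (ContinuousLinearMap.opNorm_comp_le _ _).trans ?_
    gcongr
    exact hρ i _
  | closure s hs hP v hv =>
    -- Both `G i` and `ρ i` are contractive, so replacing `v` by `u` costs at most `2 ‖v - u‖`,
    -- uniformly in `i`. This explains the split of `ε` into `ε / 2` and `2 · ε / 4` below.
    have key : ∀ u i, ‖G i ∘L v.2 - ρ i v.1 ∘L G i‖ ≤
        ‖G i ∘L u.2 - ρ i u.1 ∘L G i‖ + 2 * ‖v - u‖ := by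
      intro u i
      have e : G i ∘L v.2 - ρ i v.1 ∘L G i = (G i ∘L u.2 - ρ i u.1 ∘L G i) +
          (G i ∘L (v - u).2 - ρ i (v - u).1 ∘L G i) := by
        ext w
        simp only [Prod.snd_sub, Prod.fst_sub, map_sub, add_apply,
          sub_apply, ContinuousLinearMap.comp_apply]
        abel
      rw [e]
      refine (norm_add_le _ _).trans ?_
      gcongr
      refine (norm_sub_le _ _).trans ?_
      have h1 : ‖G i ∘L (v - u).2‖ ≤ 1 * ‖v - u‖ :=
        (ContinuousLinearMap.opNorm_comp_le _ _).trans
          (mul_le_mul (hG i) (norm_snd_le (v - u)) (norm_nonneg _) zero_le_one)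
      have h2 : ‖ρ i (v - u).1 ∘L G i‖ ≤ ‖v - u‖ * 1 :=
        (ContinuousLinearMap.opNorm_comp_le _ _).trans
          (mul_le_mul ((hρ i _).trans (norm_fst_le (v - u))) (hG i) (norm_nonneg _)
            (norm_nonneg _))
      linarith
    rw [AsympIntertwines, Metric.tendsto_nhds]
    intro ε hε
    obtain ⟨u, hu, huv⟩ := Metric.mem_closure_iff.1 hv (ε / 4) (by positivity)
    filter_upwards [(Metric.tendsto_nhds.1 (hP u hu)) (ε / 2) (by positivity)] with i hi
    rw [dist_eq_norm] at huv
    simp only [Real.dist_eq, sub_zero, abs_norm] at hi ⊢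
    linarith [key u i]

/-- If the `G i` are asymptotically isometric, then the norm of the second component is controlled
by the norms of the images of the first. -/
theorem AsympIntertwines.norm_snd_le [l.NeBot] (hG : ∀ i, ‖G i‖ ≤ 1)
    (hv : ∀ v, ∀ ε > 0, ∀ᶠ i in l, ‖v‖ - ε ≤ ‖G i v‖) {y : D × (H →L[ℂ] H)}
    (hy : AsympIntertwines l G ρ y) {c : ℝ} (hc : ∀ᶠ i in l, ‖ρ i y.1‖ ≤ c) : ‖y.2‖ ≤ c := by
  have hc0 : 0 ≤ c := by
    obtain ⟨i, hi⟩ := hc.exists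
    exact (norm_nonneg _).trans hi
  refine ContinuousLinearMap.opNorm_le_bound _ hc0 fun v => ?_
  refine le_of_forall_pos_le_add fun ε hε => ?_
  have hlim : Tendsto (fun i => ‖G i ∘L y.2 - ρ i y.1 ∘L G i‖ * ‖v‖) l (𝓝 0) := by
    simpa using Tendsto.mul_const ‖v‖ hy
  obtain ⟨i, h1, h2, h3⟩ := ((hv (y.2 v) (ε / 2) (by positivity)).and
    (hc.and (hlim.eventually_lt_const (show (0 : ℝ) < ε / 2 by positivity)))).exists
  have h4 : ‖(G i ∘L y.2 - ρ i y.1 ∘L G i) v‖ ≤ ‖G i ∘L y.2 - ρ i y.1 ∘L G i‖ * ‖v‖ :=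
    ContinuousLinearMap.le_opNorm _ _
  have h5 : ‖ρ i y.1 (G i v)‖ ≤ c * ‖v‖ :=
    (ContinuousLinearMap.le_opNorm _ _).trans (mul_le_mul h2
      (((G i).le_of_opNorm_le (hG i) v).trans_eq (one_mul _)) (norm_nonneg _) hc0)
  have h6 : ‖G i (y.2 v)‖ ≤ ‖(G i ∘L y.2 - ρ i y.1 ∘L G i) v‖ + ‖ρ i y.1 (G i v)‖ := by
    refine le_trans (le_of_eq ?_) (norm_add_le _ _)
    simp
  linarith

/-- If the `G i` are quotient maps, then the norms of the images of the first component are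
asymptotically controlled by the norm of the second. -/
theorem AsympIntertwines.eventually_norm_fst_le
    (hw : ∀ i w, ∃ v, G i v = w ∧ ‖v‖ ≤ ‖w‖) {y : D × (H →L[ℂ] H)}
    (hy : AsympIntertwines l G ρ y) (hG : ∀ i, ‖G i‖ ≤ 1) {ε : ℝ} (hε : 0 < ε) :
    ∀ᶠ i in l, ‖ρ i y.1‖ ≤ ‖y.2‖ + ε := by
  filter_upwards [Tendsto.eventually_lt_const hε hy] with i hi
  refine ContinuousLinearMap.opNorm_le_bound _ (by positivity) fun w => ?_
  obtain ⟨v, rfl, hvw⟩ := hw i w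
  have h4 : ‖(G i ∘L y.2 - ρ i y.1 ∘L G i) v‖ ≤ ε * ‖v‖ :=
    ContinuousLinearMap.le_of_opNorm_le _ hi.le _
  have h5 : ‖G i (y.2 v)‖ ≤ ‖y.2‖ * ‖v‖ :=
    ((G i).le_of_opNorm_le (hG i) _).trans ((one_mul _).trans_le (y.2.le_opNorm v))
  have h6 : ‖ρ i y.1 (G i v)‖ ≤ ‖G i (y.2 v)‖ + ‖(G i ∘L y.2 - ρ i y.1 ∘L G i) v‖ := by
    refine le_trans (le_of_eq ?_) (norm_sub_le _ _)
    simp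
  calc ‖ρ i y.1 (G i v)‖ ≤ (‖y.2‖ + ε) * ‖v‖ := by linarith
    _ ≤ (‖y.2‖ + ε) * ‖G i v‖ := by gcongr

end Asymptotic

/-! ### Homomorphisms between singly generated C*-algebras -/

section Elemental

variable {D D' : Type*} [CStarAlgebra D] [CStarAlgebra D']

/-- The C*-algebra `C*(T)` as a type. -/
def CStarGen (T : D) : Type _ := StarAlgebra.elemental ℂ T

instance (T : D) : CStarAlgebra (CStarGen T) :=
  inferInstanceAs (CStarAlgebra (StarAlgebra.elemental ℂ T))

/-- The generator of `C*(T)`. -/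
def CStarGen.gen (T : D) : CStarGen T := ⟨T, StarAlgebra.elemental.self_mem ℂ T⟩

/-- The inclusion of `C*(T)`. -/
def CStarGen.incl (T : D) : CStarGen T →⋆ₐ[ℂ] D := (StarAlgebra.elemental ℂ T).subtype

theorem CStarGen.incl_gen (T : D) : CStarGen.incl T (CStarGen.gen T) = T := rfl

theorem CStarGen.incl_injective (T : D) : Function.Injective (CStarGen.incl T) :=
  Subtype.val_injective

/-- C*-covers are generated in the non-unital sense, whereas `C*(T)` is generated as a unital
algebra; hence the separate hypothesis on `1`. -/
theorem CStarGen.eq_top_of_isClosed {T : D}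
    (S : NonUnitalStarSubalgebra ℂ (CStarGen T))
    (hS : IsClosed (S : Set (CStarGen T))) (h1 : 1 ∈ S) (hT : CStarGen.gen T ∈ S) :
    S = ⊤ := by
  rw [eq_top_iff]
  rintro ⟨x, hx⟩ -
  induction hx using StarAlgebra.elemental.induction_on with
  | self => exact hT
  | star_self => exact star_mem hT
  | algebraMap r =>
    have := S.smul_mem h1 (r := r)
    rw [← Algebra.algebraMap_eq_smul_one] at this
    exact this
  | add u hu v hv h1 h2 => exact add_mem h1 h2
  | mul u hu v hv h1 h2 => exact mul_mem h1 h2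
  | closure s hs hP v hv =>
    have hvT := closure_minimal hs (StarAlgebra.elemental.isClosed ℂ T) hv
    let s' : Set (StarAlgebra.elemental ℂ T) := {u | (u : D) ∈ s}
    have h : (⟨v, hvT⟩ : StarAlgebra.elemental ℂ T) ∈ closure s' := by
      rw [Topology.IsInducing.subtypeVal.closure_eq_preimage_closure_image]
      refine closure_mono (s := s) (t := Subtype.val '' s') (fun u hu => ?_) hv
      exact ⟨⟨u, hs hu⟩, hu, rfl⟩
    have hs' : s' ⊆ (S : Set (CStarGen T)) := fun u hu => hP u hu
    exact closure_minimal hs' hS h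

theorem denseRange_of_gen_mem {R : Type*} [Ring R] [StarRing R] [Algebra ℂ R]
    {T : D} (f : R →⋆ₐ[ℂ] CStarGen T) (hT : CStarGen.gen T ∈ Set.range f) :
    DenseRange f := by
  let S : NonUnitalStarSubalgebra ℂ (CStarGen T) :=
    (NonUnitalStarAlgHom.range (f : R →⋆ₙₐ[ℂ] CStarGen T)).topologicalClosure
  have hle : ∀ r, f r ∈ S := fun r =>
    NonUnitalStarSubalgebra.le_topologicalClosure _ ⟨r, rfl⟩
  have h := CStarGen.eq_top_of_isClosed S
    (NonUnitalStarSubalgebra.isClosed_topologicalClosure _) (map_one f ▸ hle 1)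
    (by obtain ⟨r, hr⟩ := hT; exact hr ▸ hle r)
  intro x
  have hx : x ∈ S := h ▸ trivial
  exact hx


/-- A norm inequality on `C*((T, T'))` yields a homomorphism `C*(T) → C*(T')`. -/
theorem exists_elemental_hom {T : D} {T' : D'}
    (h : ∀ y ∈ jointGen T T', ‖y.2‖ ≤ ‖y.1‖) :
    ∃ φ : CStarGen T →⋆ₐ[ℂ] CStarGen T',
      φ (CStarGen.gen T) = CStarGen.gen T' ∧
      ∀ x, (CStarGen.incl T x, CStarGen.incl T' (φ x)) ∈ jointGen T T' := by
  let R := StarAlgebra.elemental ℂ (T, T')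
  have h1 : ∀ y : R, (y : D × D').1 ∈ StarAlgebra.elemental ℂ T := fun y => by
    have : R ≤ (StarAlgebra.elemental ℂ T).comap (StarAlgHom.fst ℂ D D') :=
      StarAlgebra.elemental.le_of_mem
        ((StarAlgebra.elemental.isClosed ℂ T).preimage continuous_fst)
        (StarAlgebra.elemental.self_mem ℂ T)
    exact this y.2
  have h2 : ∀ y : R, (y : D × D').2 ∈ StarAlgebra.elemental ℂ T' := fun y => by
    have : R ≤ (StarAlgebra.elemental ℂ T').comap (StarAlgHom.snd ℂ D D') :=
      StarAlgebra.elemental.le_of_mem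
        ((StarAlgebra.elemental.isClosed ℂ T').preimage continuous_snd)
        (StarAlgebra.elemental.self_mem ℂ T')
    exact this y.2
  -- `C*((T, T'))` is a correspondence between `C*(T)` and `C*(T')`. Its first projection `σ` has
  -- dense range, and `h` says that it dominates the second one, `π`; so `π` factors through `σ`.
  let σ : CStarGen (T, T') →⋆ₐ[ℂ] CStarGen T :=
    ((StarAlgHom.fst ℂ D D').comp R.subtype).codRestrict _ h1
  let π : CStarGen (T, T') →⋆ₐ[ℂ] CStarGen T' :=
    ((StarAlgHom.snd ℂ D D').comp R.subtype).codRestrict _ h2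
  have hd : DenseRange σ := denseRange_of_gen_mem σ ⟨CStarGen.gen (T, T'), rfl⟩
  obtain ⟨φ, hφ⟩ := exists_nonUnitalStarAlgHom_of_norm_le
    (σ : CStarGen (T, T') →⋆ₙₐ[ℂ] CStarGen T) (π : CStarGen (T, T') →⋆ₙₐ[ℂ] CStarGen T') hd
    fun x => h (CStarGen.incl _ x) (Subtype.property x)
  have hφ' : ∀ r, φ (σ r) = π r := hφ
  have hφ1 : φ 1 = 1 := by rw [← map_one σ, hφ', map_one]
  refine ⟨{ φ with
      map_one' := hφ1
      commutes' := fun r => ?_ }, hφ' (CStarGen.gen (T, T')), fun x => ?_⟩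
  · change φ (algebraMap ℂ _ r) = algebraMap ℂ _ r
    rw [Algebra.algebraMap_eq_smul_one, Algebra.algebraMap_eq_smul_one, map_smul, hφ1]
  -- The graph of `φ` stays inside `C*((T, T'))`, so estimates proved for elements of the joint
  -- algebra apply to every pair `(x, φ x)`.
  · change (CStarGen.incl T x, CStarGen.incl T' (φ x)) ∈ jointGen T T'
    have hc : Continuous φ := by
      have : ContinuousLinearMapClass _ ℂ _ _ :=
        NonUnitalStarAlgHom.instContinuousLinearMapClassComplex
          (F := CStarGen T →⋆ₙₐ[ℂ] CStarGen T')
      exact map_continuous φ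
    have hi : Continuous (CStarGen.incl T) := continuous_subtype_val
    have hi' : Continuous (CStarGen.incl T') := continuous_subtype_val
    have hcl : IsClosed (jointGen T T') := StarAlgebra.elemental.isClosed ℂ (T, T')
    refine hd.induction_on
      (p := fun x => (CStarGen.incl T x, CStarGen.incl T' (φ x)) ∈ jointGen T T') x
      (hcl.preimage (by fun_prop)) fun r => ?_
    rw [hφ']
    exact r.2

end Elemental

/-! ### Polynomials in the disc algebra -/

section DiscAlgebra

open Polynomial

/-- The coordinate function on the closed disc. -/
def discCoord : C(Metric.closedBall (0 : ℂ) 1, ℂ) := ⟨fun z => (z : ℂ), continuous_subtype_val⟩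

theorem aeval_discCoord_apply (p : ℂ[X]) (z : Metric.closedBall (0 : ℂ) 1) :
    aeval discCoord p z = p.eval (z : ℂ) := by
  induction p using Polynomial.induction_on' with
  | add p q hp hq => simp [hp, hq]
  | monomial n a => simp [aeval_monomial, discCoord, Algebra.algebraMap_eq_smul_one]

theorem aeval_discCoord_mem (p : ℂ[X]) : aeval discCoord p ∈ discAlgebra :=
  ⟨fun z => p.eval z, p.differentiable.differentiableOn, fun z => (aeval_discCoord_apply p z).symm⟩

/-- Polynomials as elements of the disc algebra. -/
def polyDisc : ℂ[X] →ₙₐ[ℂ] discAlgebra where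
  toFun p := ⟨aeval discCoord p, aeval_discCoord_mem p⟩
  map_smul' c p := Subtype.ext (map_smul (aeval discCoord) c p)
  map_zero' := Subtype.ext (map_zero (aeval discCoord))
  map_add' p q := Subtype.ext (map_add (aeval discCoord) p q)
  map_mul' p q := Subtype.ext (map_mul (aeval discCoord) p q)

theorem coe_polyDisc (p : ℂ[X]) : (polyDisc p : C(Metric.closedBall (0 : ℂ) 1, ℂ)) =
    aeval discCoord p := rfl

theorem polyDisc_X : polyDisc X = discZ := Subtype.ext (aeval_X _)

instance : NormedSpace ℂ discAlgebra where
  norm_smul_le c x := norm_smul_le c (x : C(Metric.closedBall (0 : ℂ) 1, ℂ))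

/-- The dilate `z ↦ g (r z)` is holomorphic on a larger disc, so its Taylor polynomials converge
uniformly on the closed unit disc. -/
theorem exists_polynomial_approx {g : ℂ → ℂ} (hg : DifferentiableOn ℂ g (Metric.ball 0 1))
    {r : ℝ} (hr0 : 0 < r) (hr : r < 1) {ε : ℝ} (hε : 0 < ε) :
    ∃ p : ℂ[X], ∀ z : ℂ, ‖z‖ ≤ 1 → ‖g (r * z) - p.eval z‖ < ε := by
  -- With `r < r' < R < 1`, the Cauchy series on the disc of radius `R` converges uniformly on the
  -- one of radius `r'`, which contains all `r z` with `‖z‖ ≤ 1`.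
  obtain ⟨r', hr', hr1⟩ := exists_between hr
  obtain ⟨R, hR, hR1⟩ := exists_between hr1
  have hr'0 : 0 < r' := hr0.trans hr'
  have hR0 : 0 < R := hr'0.trans hR
  lift R to NNReal using hR0.le
  lift r' to NNReal using hr'0.le
  have hps := (hg.mono (Metric.closedBall_subset_ball hR1)).hasFPowerSeriesOnBall
    (by exact_mod_cast hR0)
  have hu := hps.tendstoUniformlyOn (r' := r') (by exact_mod_cast hR)
  rw [Metric.tendstoUniformlyOn_iff] at hu
  obtain ⟨n, hn⟩ := (hu ε hε).exists
  set s := cauchyPowerSeries g 0 R with hs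
  refine ⟨∑ k ∈ Finset.range n, C (s.coeff k * (r : ℂ) ^ k) * X ^ k, fun z hz => ?_⟩
  have hz' : (r : ℂ) * z ∈ Metric.ball (0 : ℂ) r' := by
    rw [mem_ball_zero_iff, norm_mul, Complex.norm_real, Real.norm_of_nonneg hr0.le]
    nlinarith [norm_nonneg z]
  have := hn _ hz'
  rw [dist_eq_norm, zero_add, FormalMultilinearSeries.partialSum] at this
  have e : (∑ k ∈ Finset.range n, C (s.coeff k * (r : ℂ) ^ k) * X ^ k).eval z =
      ∑ k ∈ Finset.range n, (s k) fun _ => (r : ℂ) * z := by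
    rw [eval_finsetSum]
    refine Finset.sum_congr rfl fun k _ => ?_
    rw [FormalMultilinearSeries.apply_eq_pow_smul_coeff]
    simp only [eval_mul, eval_C, eval_pow, eval_X, mul_pow, smul_eq_mul]
    ring
  rwa [e]

theorem denseRange_polyDisc : DenseRange polyDisc := by
  rintro ⟨f, g, hg, hgf⟩
  rw [Metric.mem_closure_iff]
  intro ε hε
  have hfu : UniformContinuous f := CompactSpace.uniformContinuous_of_continuous f.continuous
  obtain ⟨δ, hδ, hfδ⟩ := Metric.uniformContinuous_iff.1 hfu (ε / 4) (by positivity)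
  -- The bound `1 - δ` gives `‖z - r z‖ < δ` on the disc; `1 / 2` only keeps `r` positive.
  obtain ⟨r, hr, hr1⟩ := exists_between (show max (1 / 2) (1 - δ) < 1 by
    rw [max_lt_iff]; constructor <;> linarith)
  rw [max_lt_iff] at hr
  have hr0 : 0 < r := by linarith
  obtain ⟨p, hp⟩ := exists_polynomial_approx hg hr0 hr1 (ε := ε / 4) (by positivity)
  refine ⟨polyDisc p, ⟨p, rfl⟩, ?_⟩
  rw [Subtype.dist_eq, dist_eq_norm]
  refine lt_of_le_of_lt (b := ε / 2) ?_ (by linarith)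
  refine (ContinuousMap.norm_le _ (by positivity)).2 fun z => ?_
  have hz : ‖(z : ℂ)‖ ≤ 1 := mem_closedBall_zero_iff.1 z.2
  have hrz : ‖(r : ℂ) * z‖ ≤ 1 := by
    rw [norm_mul, Complex.norm_real, Real.norm_of_nonneg hr0.le]
    nlinarith [norm_nonneg (z : ℂ)]
  let w : Metric.closedBall (0 : ℂ) 1 := ⟨r * z, by simpa using hrz⟩
  have h1 : dist (f z) (f w) < ε / 4 := by
    refine hfδ ?_
    rw [Subtype.dist_eq, dist_eq_norm]
    have : (z : ℂ) - w = ((1 - r : ℝ) : ℂ) * z := by simp [w]; ring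
    rw [this, norm_mul, Complex.norm_real, Real.norm_of_nonneg (by linarith)]
    nlinarith [norm_nonneg (z : ℂ)]
  have h2 := hp z hz
  have h3 : g (r * z) = f w := hgf w
  rw [h3] at h2
  rw [dist_eq_norm] at h1
  rw [coe_polyDisc, ContinuousMap.sub_apply, aeval_discCoord_apply]
  calc ‖f z - p.eval (z : ℂ)‖ = ‖(f z - f w) + (f w - p.eval (z : ℂ))‖ := by ring_nf
    _ ≤ ‖f z - f w‖ + ‖f w - p.eval (z : ℂ)‖ := norm_add_le _ _
    _ ≤ ε / 2 := by linarith

/-- The maximum modulus principle for matrices of polynomials. -/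
theorem matNorm_aeval_discCoord_le {n : ℕ} (P : Matrix (Fin n) (Fin n) ℂ[X]) {c : ℝ}
    (h : ∀ ω : ℂ, ‖ω‖ = 1 → matNorm (P.map fun p => p.eval ω) ≤ c) :
    matNorm (P.map fun p => aeval discCoord p) ≤ c := by
  have hc : 0 ≤ c := (matNorm_nonneg _).trans (h 1 (by simp))
  refine matNorm_le_of_forall
    (fun z : Metric.closedBall (0 : ℂ) 1 =>
      ((ContinuousMap.evalStarAlgHom ℂ ℂ z : C(Metric.closedBall (0 : ℂ) 1, ℂ) →⋆ₐ[ℂ] ℂ) :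
        C(Metric.closedBall (0 : ℂ) 1, ℂ) →⋆ₙₐ[ℂ] ℂ))
    (fun f hf => ContinuousMap.ext hf) hc fun z => ?_
  have e : ((P.map fun p => aeval discCoord p).map
      ((ContinuousMap.evalStarAlgHom ℂ ℂ z : C(Metric.closedBall (0 : ℂ) 1, ℂ) →⋆ₐ[ℂ] ℂ) :
        C(Metric.closedBall (0 : ℂ) 1, ℂ) →⋆ₙₐ[ℂ] ℂ)) = P.map fun p => p.eval (z : ℂ) := by
    ext i j
    exact aeval_discCoord_apply _ _
  rw [e]
  let : PartialOrder ℂ := CStarAlgebra.spectralOrder ℂ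
  have : StarOrderedRing ℂ := CStarAlgebra.spectralOrderedRing ℂ
  let F : ℂ → CStarMatrix (Fin n) (Fin n) ℂ := fun w =>
    CStarMatrix.ofMatrix (P.map fun p => p.eval w)
  -- Expanding in matrix units exhibits `F` as an entire function with values in a Banach space, to
  -- which the maximum modulus principle applies.
  have hFs : F = fun w => ∑ i, ∑ j, (P i j).eval w •
      (CStarMatrix.ofMatrix (Matrix.single i j 1) : CStarMatrix (Fin n) (Fin n) ℂ) := by
    funext w
    refine (Matrix.matrix_eq_sum_single (P.map fun p => p.eval w)).trans ?_
    refine Finset.sum_congr rfl fun i _ => Finset.sum_congr rfl fun j _ => ?_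
    change Matrix.single i j ((P i j).eval w) = (P i j).eval w • Matrix.single i j (1 : ℂ)
    rw [Matrix.smul_single, smul_eq_mul, mul_one]
  have hF : Differentiable ℂ F := by
    rw [hFs]
    refine Differentiable.fun_sum fun i _ => Differentiable.fun_sum fun j _ => ?_
    exact (P i j).differentiable.smul_const _
  refine Complex.norm_le_of_forall_mem_frontier_norm_le (U := Metric.ball 0 1) (f := F)
    Metric.isBounded_ball hF.diffContOnCl (fun w hw => ?_) (z := z) ?_
  · rw [frontier_ball (0 : ℂ) one_ne_zero, mem_sphere_zero_iff_norm] at hw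
    exact h w hw
  · rw [closure_ball (0 : ℂ) one_ne_zero]
    exact z.2

end DiscAlgebra

/-! ### Singly generated covers -/

section Covers

open Polynomial

variable {D : Type u} [CStarAlgebra D]

/-- An element of a C*-algebra with a completely isometric polynomial functional calculus. -/
def IsPolyCompletelyIsometric (T : D) : Prop :=
  ∀ (n : ℕ) (P : Matrix (Fin n) (Fin n) ℂ[X]),
    matNorm (P.map fun p => aeval T p) = matNorm (P.map fun p => aeval discCoord p)

/-- The `1 × 1` case makes the polynomial calculus isometric, so it extends from the dense
polynomials. Equality of matrix norms passes to the limit by continuity. -/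
theorem IsPolyCompletelyIsometric.exists_embedding {T : D} (hT : IsPolyCompletelyIsometric T) :
    ∃ ι : discAlgebra →ₙₐ[ℂ] CStarGen T, IsCompletelyIsometric ι ∧
      ∀ p, ι (polyDisc p) = aeval (CStarGen.gen T) p := by
  let π : ℂ[X] →ₙₐ[ℂ] CStarGen T := (aeval (CStarGen.gen T) : ℂ[X] →ₐ[ℂ] _)
  have hπc : ∀ p, CStarGen.incl T (π p) = aeval T p := fun p =>
    (aeval_algHom_apply (CStarGen.incl T).toAlgHom (CStarGen.gen T) p).symm
  have hmat : ∀ (n : ℕ) (P : Matrix (Fin n) (Fin n) ℂ[X]),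
      matNorm (P.map π) = matNorm (P.map fun p => aeval discCoord p) := fun n P => by
    rw [← hT, ← matNorm_map_of_injective
      (CStarGen.incl T : CStarGen T →⋆ₙₐ[ℂ] D) (CStarGen.incl_injective T)]
    congr 1
    ext i j
    exact hπc _
  have hn : ∀ p, ‖π p‖ = ‖polyDisc p‖ := fun p => by
    have := hmat 1 (Matrix.of fun _ _ => p)
    rw [← norm_eq_matNorm_fin_one (π p)]
    refine this.trans ?_
    exact norm_eq_matNorm_fin_one (aeval discCoord p)
  obtain ⟨ι, hc, -, hι⟩ := exists_nonUnitalAlgHom_of_norm_le polyDisc π denseRange_polyDisc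
    fun p => (hn p).le
  refine ⟨ι, fun n a => ?_, hι⟩
  have hd : DenseRange fun P : Matrix (Fin n) (Fin n) ℂ[X] => P.map polyDisc :=
    DenseRange.piMap fun _ => DenseRange.piMap fun _ => denseRange_polyDisc
  refine hd.induction_on (p := fun a : Matrix (Fin n) (Fin n) discAlgebra =>
    matNorm (a.map fun x => ι x) =
      matNorm (a.map fun x => (x : C(Metric.closedBall (0 : ℂ) 1, ℂ)))) a
    (isClosed_eq ?_ ?_) fun P => ?_
  · exact continuous_matNorm.comp (continuous_id.matrix_map hc)
  · exact continuous_matNorm.comp (continuous_id.matrix_map continuous_subtype_val)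
  · rw [Matrix.map_map, Matrix.map_map]
    refine Eq.trans ?_ (hmat n P)
    congr 1
    ext i j
    simp [hι]

/-- `C*(T)` as a cover of the disc algebra. -/
def IsPolyCompletelyIsometric.cover {T : D} (hT : IsPolyCompletelyIsometric T) :
    CStarCover.{u} discAlgebra where
  alg := CStarGen T
  ι := hT.exists_embedding.choose
  completelyIsometric := hT.exists_embedding.choose_spec.1
  generates := by
    have h := hT.exists_embedding.choose_spec.2
    set ι := hT.exists_embedding.choose
    have hmem : ∀ a, ι a ∈ (NonUnitalStarAlgebra.adjoin ℂ (Set.range ι)).topologicalClosure :=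
      fun a => NonUnitalStarSubalgebra.le_topologicalClosure _
        (NonUnitalStarAlgebra.subset_adjoin ℂ _ ⟨a, rfl⟩)
    refine CStarGen.eq_top_of_isClosed _
      (NonUnitalStarSubalgebra.isClosed_topologicalClosure _) ?_ ?_
    · have := hmem (polyDisc 1)
      rwa [h, map_one] at this
    · have := hmem (polyDisc X)
      rwa [h, aeval_X] at this

theorem IsPolyCompletelyIsometric.cover_ι_poly {T : D} (hT : IsPolyCompletelyIsometric T)
    (p : ℂ[X]) : hT.cover.ι (polyDisc p) = aeval (CStarGen.gen T) p :=
  hT.exists_embedding.choose_spec.2 p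

theorem IsPolyCompletelyIsometric.isCoverOf {T : D} (hT : IsPolyCompletelyIsometric T) :
    IsCoverOf hT.cover T := by
  refine ⟨StarAlgEquiv.refl ℂ (StarAlgebra.elemental ℂ T), ?_⟩
  have := hT.cover_ι_poly X
  rw [polyDisc_X, aeval_X] at this
  exact congrArg Subtype.val this

theorem CStarCover.continuous_ι {E : Type v} [NonUnitalCStarAlgebra E]
    {A : NonUnitalSubalgebra ℂ E} (B : CStarCover.{u} A) : Continuous B.ι := by
  refine AddMonoidHomClass.continuous_of_bound B.ι 1 fun a => ?_
  have := B.completelyIsometric 1 (Matrix.of fun _ _ => a)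
  rw [one_mul]
  refine le_of_eq ((norm_eq_matNorm_fin_one (B.ι a)).symm.trans (this.trans ?_))
  exact norm_eq_matNorm_fin_one (a : E)

/-- A *-homomorphism between covers of the disc algebra is a morphism as soon as it is compatible
with the polynomials. -/
theorem CStarCover.eq_of_poly {B C : CStarCover.{u} discAlgebra} (π : C.alg →⋆ₙₐ[ℂ] B.alg)
    (h : ∀ p, π (C.ι (polyDisc p)) = B.ι (polyDisc p)) (a : discAlgebra) :
    π (C.ι a) = B.ι a := by
  have hπ : Continuous π :=
    AddMonoidHomClass.continuous_of_bound π 1 fun x => by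
      simpa using NonUnitalStarAlgHom.norm_apply_le π x
  exact denseRange_polyDisc.induction_on (p := fun a => π (C.ι a) = B.ι a) a
    (isClosed_eq (hπ.comp C.continuous_ι) B.continuous_ι) h

end Covers

/-! ### Truncated shifts: von Neumann's inequality -/

section VonNeumann

open Polynomial

/-- Restriction to the spectrum, a subset of the circle, followed by the continuous functional
calculus is a *-homomorphism sending the coordinate function to `U`. -/
theorem matNorm_aeval_unitary_le {D : Type*} [CStarAlgebra D] {U : D} (hU : U ∈ unitary D) {n : ℕ}
    (P : Matrix (Fin n) (Fin n) ℂ[X]) :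
    matNorm (P.map fun p => aeval U p) ≤ matNorm (P.map fun p => aeval discCoord p) := by
  have hN : IsStarNormal U := isStarNormal_of_mem_unitary hU
  have hs : spectrum ℂ U ⊆ Metric.closedBall 0 1 :=
    (spectrum.subset_circle_of_unitary hU).trans Metric.sphere_subset_closedBall
  let r : C(spectrum ℂ U, Metric.closedBall (0 : ℂ) 1) :=
    ⟨Set.inclusion hs, continuous_inclusion hs⟩
  let Ψ : C(Metric.closedBall (0 : ℂ) 1, ℂ) →⋆ₐ[ℂ] D :=
    (cfcHom hN : C(spectrum ℂ U, ℂ) →⋆ₐ[ℂ] D).comp (ContinuousMap.compStarAlgHom' ℂ ℂ r)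
  have hΨ : Ψ discCoord = U := cfcHom_id hN
  have h := matNorm_map_le (Ψ : C(Metric.closedBall (0 : ℂ) 1, ℂ) →⋆ₙₐ[ℂ] D)
    (P.map fun p => aeval discCoord p)
  rw [Matrix.map_map] at h
  refine le_of_eq_of_le ?_ h
  congr 1
  ext i j
  have := aeval_algHom_apply Ψ.toAlgHom discCoord (P i j)
  rw [show Ψ.toAlgHom discCoord = U from hΨ] at this
  exact this

theorem truncShift_pow_apply (n k : ℕ) (i j : Fin n) :
    (truncShift n ^ k) i j = if (i : ℕ) = j + k then 1 else 0 := by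
  induction k generalizing j with
  | zero => simp [Matrix.one_apply, Fin.ext_iff]
  | succ k ih =>
    rw [pow_succ, Matrix.mul_apply]
    simp_rw [ih]
    by_cases hj : (j : ℕ) + 1 < n
    · rw [Finset.sum_eq_single (⟨j + 1, hj⟩ : Fin n)]
      · simp only [truncShift, Matrix.of_apply, if_true, mul_one]
        congr 1
        rw [eq_iff_iff]
        omega
      · intro m _ hm
        have hm' : (m : ℕ) ≠ j + 1 := fun e => hm (Fin.ext e)
        simp [truncShift, hm']
      · simp
    · rw [Finset.sum_eq_zero, if_neg]
      · omega
      · intro m _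
        have hm' : (m : ℕ) ≠ j + 1 := fun e => hj (e ▸ m.2)
        simp [truncShift, hm']

/-- The cyclic shift. -/
def cyclicShift (N : ℕ) [NeZero N] : Matrix (ZMod N) (ZMod N) ℂ :=
  Matrix.of fun i j => if i = j + 1 then 1 else 0

theorem cyclicShift_pow_apply (N : ℕ) [NeZero N] (k : ℕ) (i j : ZMod N) :
    (cyclicShift N ^ k) i j = if i = j + k then 1 else 0 := by
  induction k generalizing j with
  | zero => simp [Matrix.one_apply]
  | succ k ih =>
    rw [pow_succ, Matrix.mul_apply]
    simp_rw [ih]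
    rw [Finset.sum_eq_single (j + 1)]
    · simp only [cyclicShift, Matrix.of_apply, if_true, mul_one, Nat.cast_succ]
      congr 2
      ring
    · intro m _ hm
      simp [cyclicShift, hm]
    · simp

theorem cyclicShift_mem_unitary (N : ℕ) [NeZero N] :
    cyclicShift N ∈ unitary (Matrix (ZMod N) (ZMod N) ℂ) := by
  have h : star (cyclicShift N) * cyclicShift N = 1 := by
    ext i j
    rw [Matrix.mul_apply, Finset.sum_eq_single (j + 1)]
    · simp [cyclicShift, Matrix.one_apply, eq_comm]
    · intro m _ hm
      simp [cyclicShift, hm]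
    · simp
  exact Unitary.mem_iff.2 ⟨h, mul_eq_one_comm.1 h⟩

/-- A finite unitary dilation: up to the degree that occurs in `P`, powers of `S_m` are compressions
of powers of a sufficiently large cyclic permutation matrix. -/
theorem matNorm_aeval_truncShift_le (m : ℕ) {n : ℕ} (P : Matrix (Fin n) (Fin n) ℂ[X]) :
    matNorm (P.map fun p => aeval (truncShift m) p) ≤
      matNorm (P.map fun p => aeval discCoord p) := by
  obtain ⟨d, hd⟩ : ∃ d, ∀ i j, (P i j).natDegree ≤ d :=
    ⟨Finset.univ.sup fun i => Finset.univ.sup fun j => (P i j).natDegree, fun i j =>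
      (Finset.le_sup (f := fun j => (P i j).natDegree) (Finset.mem_univ j)).trans
      (Finset.le_sup (f := fun i => Finset.univ.sup fun j => (P i j).natDegree)
        (Finset.mem_univ i))⟩
  -- For `j < m` and `k ≤ d` the index `j + k` stays below `N`, so the first `d` powers of the
  -- cyclic shift do not wrap around into the corner of size `m`.
  set N := m + d + 1 with hN
  have : NeZero N := ⟨by omega⟩
  have hcast : ∀ a b : ℕ, a < N → b < N → ((a : ZMod N) = b ↔ a = b) := fun a b ha hb => by
    rw [ZMod.natCast_eq_natCast_iff, Nat.ModEq, Nat.mod_eq_of_lt ha, Nat.mod_eq_of_lt hb]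
  let V : Matrix (ZMod N) (Fin m) ℂ := Matrix.of fun x i => if x = ((i : ℕ) : ZMod N) then 1 else 0
  have hV : ∀ (A : Matrix (ZMod N) (ZMod N) ℂ) (i j : Fin m),
      (V.conjTranspose * A * V) i j = A (i : ℕ) (j : ℕ) := fun A i j => by
    simp [V, Matrix.mul_apply, Matrix.conjTranspose_apply, apply_ite]
  have hV1 : V.conjTranspose * V = 1 := by
    ext i j
    have := hV 1 i j
    rw [Matrix.mul_one] at this
    rw [this, Matrix.one_apply, Matrix.one_apply]
    congr 1
    rw [hcast _ _ (by omega) (by omega), Fin.ext_iff]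
  -- Embedding `M_m` as a corner, by a non-unital *-homomorphism, turns `V* · V` into compression by
  -- the projection `V V*` inside a single algebra.
  let J : Matrix (Fin m) (Fin m) ℂ →⋆ₙₐ[ℂ] Matrix (ZMod N) (ZMod N) ℂ :=
    { toFun := fun a => V * a * V.conjTranspose
      map_smul' := fun c a => by simp
      map_zero' := by simp
      map_add' := fun a b => by rw [Matrix.mul_add, Matrix.add_mul]
      map_mul' := fun a b => by
        calc V * (a * b) * V.conjTranspose = V * a * (1 : Matrix (Fin m) (Fin m) ℂ) * b * V.conjTranspose := by
              simp only [Matrix.mul_one, Matrix.mul_assoc]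
          _ = _ := by rw [← hV1]; simp only [Matrix.mul_assoc]
      map_star' := fun a => by
        simp [Matrix.star_eq_conjTranspose, Matrix.conjTranspose_mul, Matrix.mul_assoc] }
  have hJ : Function.Injective J := by
    intro a b h
    have h1 : V * a * V.conjTranspose = V * b * V.conjTranspose := h
    have h2 := congrArg (fun x => V.conjTranspose * x * V) h1
    simpa only [Matrix.mul_assoc, hV1, Matrix.mul_one, ← Matrix.mul_assoc V.conjTranspose V,
      Matrix.one_mul] using h2
  have hQ : IsStarProjection (V * V.conjTranspose) := by
    constructor
    · change V * V.conjTranspose * (V * V.conjTranspose) = V * V.conjTranspose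
      rw [Matrix.mul_assoc, ← Matrix.mul_assoc V.conjTranspose, hV1, Matrix.one_mul]
    · change (V * V.conjTranspose).conjTranspose = V * V.conjTranspose
      rw [Matrix.conjTranspose_mul, Matrix.conjTranspose_conjTranspose]
  have key : ∀ p : ℂ[X], p.natDegree ≤ d →
      aeval (truncShift m) p = V.conjTranspose * aeval (cyclicShift N) p * V := fun p hp => by
    ext i j
    rw [hV, aeval_eq_sum_range, aeval_eq_sum_range, Matrix.sum_apply, Matrix.sum_apply]
    refine Finset.sum_congr rfl fun k hk => ?_
    rw [Finset.mem_range] at hk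
    rw [Matrix.smul_apply, Matrix.smul_apply, truncShift_pow_apply, cyclicShift_pow_apply]
    congr 2
    rw [← Nat.cast_add, hcast _ _ (by omega) (by omega)]
  rw [← matNorm_map_of_injective J hJ]
  refine le_trans (le_of_eq ?_) ((matNorm_compress_le hQ _).trans
    (matNorm_aeval_unitary_le (cyclicShift_mem_unitary N) P))
  congr 1
  ext1 i j
  change V * aeval (truncShift m) (P i j) * V.conjTranspose =
    V * V.conjTranspose * aeval (cyclicShift N) (P i j) * (V * V.conjTranspose)
  rw [key _ (hd i j)]
  simp only [Matrix.mul_assoc]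

/-- The coordinate homomorphisms of a product of matrix algebras. -/
def matProdEval {X : Set ℕ+} (n : X) :
    MatProd X →⋆ₐ[ℂ] Matrix (Fin (n : ℕ+)) (Fin (n : ℕ+)) ℂ where
  toFun x := x n
  map_one' := by rw [lp.infty_coeFn_one]; rfl
  map_mul' x y := by rw [lp.infty_coeFn_mul]; rfl
  map_zero' := rfl
  map_add' _ _ := rfl
  commutes' _ := rfl
  map_star' _ := rfl

theorem matNorm_aeval_truncShiftSum_le (X : Set ℕ+) {n : ℕ} (P : Matrix (Fin n) (Fin n) ℂ[X]) :
    matNorm (P.map fun p => aeval (truncShiftSum X) p) ≤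
      matNorm (P.map fun p => aeval discCoord p) := by
  refine matNorm_le_of_forall (fun m : X => (matProdEval m :
      MatProd X →⋆ₙₐ[ℂ] Matrix (Fin (m : ℕ+)) (Fin (m : ℕ+)) ℂ))
    (fun a ha => ?_) (matNorm_nonneg _) fun m => ?_
  · ext1
    funext m
    exact ha m
  · rw [Matrix.map_map]
    refine le_of_eq_of_le ?_ (matNorm_aeval_truncShift_le (m : ℕ+) P)
    congr 1
    ext1 i j
    exact (aeval_algHom_apply (matProdEval m).toAlgHom (truncShiftSum X) (P i j)).symm

end VonNeumann

/-! ### Shifts on `ℓ²` -/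

section Shifts

open Filter Topology

/-- The Hilbert space `ℓ² ⊕ ℓ²`. -/
abbrev EllTwoSum : Type := WithLp 2 (EllTwo × EllTwo)

theorem EllTwo.sum_sq_le (x : EllTwo) (s : Finset ℕ) : ∑ i ∈ s, ‖x i‖ ^ 2 ≤ ‖x‖ ^ 2 := by
  simpa using lp.sum_rpow_le_norm_rpow (p := 2) (by norm_num) x s

theorem EllTwo.sum_sq_le_of_injective {κ : Type*} [Fintype κ] (x : EllTwo) {g : κ → ℕ}
    (hg : Function.Injective g) : ∑ i, ‖x (g i)‖ ^ 2 ≤ ‖x‖ ^ 2 := by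
  have := x.sum_sq_le (Finset.univ.map ⟨g, hg⟩)
  rwa [Finset.sum_map] at this

theorem unilateralShift_apply (x : EllTwo) (i : ℕ) : unilateralShift x i = shiftSeq x i := rfl

theorem norm_unilateralShift_apply_le (x : EllTwo) : ‖unilateralShift x‖ ≤ ‖x‖ := by
  have : ‖unilateralShift‖ ≤ 1 := LinearMap.mkContinuous_norm_le _ zero_le_one _
  simpa using unilateralShift.le_of_opNorm_le this x

theorem unilateralShift_single (i : ℕ) (c : ℂ) :
    unilateralShift (lp.single 2 i c) = lp.single 2 (i + 1) c := by
  ext j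
  rw [unilateralShift_apply]
  cases j with
  | zero => simp [shiftSeq]
  | succ j => simp [shiftSeq, Pi.single_apply]

/-- The backward shift. -/
abbrev backwardShift : EllTwo →L[ℂ] EllTwo := ContinuousLinearMap.adjoint unilateralShift

theorem backwardShift_apply (x : EllTwo) (i : ℕ) : backwardShift x i = x (i + 1) := by
  have h := ContinuousLinearMap.adjoint_inner_right unilateralShift (lp.single 2 i (1 : ℂ)) x
  rw [unilateralShift_single, lp.inner_single_left, lp.inner_single_left] at h
  simpa using h

theorem norm_backwardShift_apply_le (x : EllTwo) : ‖backwardShift x‖ ≤ ‖x‖ := by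
  have : ‖backwardShift‖ ≤ 1 := by
    rw [LinearIsometryEquiv.norm_map]
    exact LinearMap.mkContinuous_norm_le _ zero_le_one _
  simpa using backwardShift.le_of_opNorm_le this x

theorem shiftSumAdjoint_fst (v : EllTwoSum) :
    (shiftSumAdjoint v).fst = unilateralShift v.fst := rfl

theorem shiftSumAdjoint_snd (v : EllTwoSum) :
    (shiftSumAdjoint v).snd = backwardShift v.snd := rfl

theorem star_shiftSumAdjoint_apply (v : EllTwoSum) : star shiftSumAdjoint v =
    WithLp.toLp 2 (backwardShift v.fst, unilateralShift v.snd) := by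
  refine ext_inner_left ℂ fun w => ?_
  rw [ContinuousLinearMap.star_eq_adjoint, ContinuousLinearMap.adjoint_inner_right,
    WithLp.prod_inner_apply, WithLp.prod_inner_apply]
  congr 1
  · exact (ContinuousLinearMap.adjoint_inner_right unilateralShift w.fst v.fst).symm
  · exact ContinuousLinearMap.adjoint_inner_left unilateralShift v.snd w.snd

theorem truncShift_mulVec {n : ℕ} {w : Fin n → ℂ} (f : ℕ → ℂ) (h : ∀ i : Fin n, w i = f i)
    (i : Fin n) : (truncShift n).mulVec w i = shiftSeq f i := by
  rw [Matrix.mulVec, dotProduct]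
  rcases i with ⟨_ | i, hi⟩
  · simp [truncShift, shiftSeq]
  · rw [Finset.sum_eq_single (⟨i, by omega⟩ : Fin n)]
    · simp [truncShift, shiftSeq, h]
    · intro m _ hm
      have hm' : i ≠ (m : ℕ) := fun e => hm (Fin.ext e.symm)
      simp [truncShift, hm']
    · simp

theorem truncShift_conjTranspose_mulVec {n : ℕ} {w : Fin n → ℂ} (f : ℕ → ℂ)
    (h : ∀ i : Fin n, w i = f i) (i : Fin n) :
    (truncShift n).conjTranspose.mulVec w i = if (i : ℕ) + 1 < n then f (i + 1) else 0 := by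
  rw [Matrix.mulVec, dotProduct]
  split_ifs with hi
  · rw [Finset.sum_eq_single (⟨i + 1, hi⟩ : Fin n)]
    · simp [truncShift, h]
    · intro m _ hm
      have hm' : (m : ℕ) ≠ i + 1 := fun e => hm (Fin.ext e)
      simp [truncShift, hm']
    · simp
  · refine Finset.sum_eq_zero fun m _ => ?_
    have hm' : (m : ℕ) ≠ i + 1 := fun e => hi (e ▸ m.2)
    simp [truncShift, hm']

/-! ### The asymptotically isometric quotient maps `ℓ² ⊕ ℓ² → ℂⁿ` -/

/-- The coordinates of the image of `v ∈ ℓ² ⊕ ℓ²` in `ℂⁿ`. -/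
def blendSeq (n : ℕ) (v : EllTwoSum) (i : ℕ) : ℂ :=
  (√(1 - i / n) : ℝ) * v.fst i + (√(i / n) : ℝ) * v.snd (n - 1 - i)

theorem norm_ofReal_add_sq_le {c s : ℝ} (h : c ^ 2 + s ^ 2 ≤ 1) (a b : ℂ) :
    ‖(c : ℂ) * a + (s : ℂ) * b‖ ^ 2 ≤ ‖a‖ ^ 2 + ‖b‖ ^ 2 := by
  have h1 : ‖(c : ℂ) * a + (s : ℂ) * b‖ ≤ |c| * ‖a‖ + |s| * ‖b‖ := by
    refine (norm_add_le _ _).trans (le_of_eq ?_)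
    rw [norm_mul, norm_mul, Complex.norm_real, Complex.norm_real, Real.norm_eq_abs,
      Real.norm_eq_abs]
  have h2 : (|c| * ‖a‖ + |s| * ‖b‖) ^ 2 ≤ (|c| ^ 2 + |s| ^ 2) * (‖a‖ ^ 2 + ‖b‖ ^ 2) := by
    nlinarith [sq_nonneg (|c| * ‖b‖ - |s| * ‖a‖)]
  rw [sq_abs, sq_abs] at h2
  calc _ ≤ (|c| * ‖a‖ + |s| * ‖b‖) ^ 2 := by gcongr
    _ ≤ _ := h2
    _ ≤ 1 * (‖a‖ ^ 2 + ‖b‖ ^ 2) := by gcongr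
    _ = _ := one_mul _

theorem sum_fin_sq_le (n : ℕ) (x y : EllTwo) :
    ∑ i : Fin n, (‖x i‖ ^ 2 + ‖y (n - 1 - i)‖ ^ 2) ≤ ‖x‖ ^ 2 + ‖y‖ ^ 2 := by
  rw [Finset.sum_add_distrib]
  refine add_le_add (x.sum_sq_le_of_injective Fin.val_injective)
    (y.sum_sq_le_of_injective (g := fun i : Fin n => n - 1 - i) fun i j h => ?_)
  simp only at h
  ext
  omega

theorem sq_blend_coeff {n i : ℕ} (hi : i ≤ n) (hn : 0 < n) :
    √(1 - (i : ℝ) / n) ^ 2 + √((i : ℝ) / n) ^ 2 = 1 := by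
  have h1 : (i : ℝ) / n ≤ 1 := by
    rw [div_le_one (by positivity)]
    exact_mod_cast hi
  rw [Real.sq_sqrt (by linarith), Real.sq_sqrt (by positivity)]
  ring

/-- The map `ℓ² ⊕ ℓ² → ℂⁿ` which blends the first coordinates of the first summand with the
reflected first coordinates of the second summand. -/
def blend (n : ℕ) : EllTwoSum →L[ℂ] EuclideanSpace ℂ (Fin n) :=
  LinearMap.mkContinuous
    { toFun := fun v => WithLp.toLp 2 fun i => blendSeq n v i
      map_add' := fun v w => by
        ext i
        simp [blendSeq]
        ring
      map_smul' := fun c v => by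
        ext i
        simp [blendSeq]
        ring }
    1 fun v => by
      rw [one_mul]
      refine abs_le_of_sq_le_sq' ?_ (norm_nonneg v) |>.2
      rw [EuclideanSpace.norm_sq_eq, WithLp.prod_norm_sq_eq_of_L2]
      refine le_trans (Finset.sum_le_sum fun i _ => ?_) (sum_fin_sq_le n v.fst v.snd)
      exact norm_ofReal_add_sq_le (sq_blend_coeff i.2.le (i.pos)).le _ _

theorem blend_apply (n : ℕ) (v : EllTwoSum) (i : Fin n) : blend n v i = blendSeq n v i := rfl

theorem norm_blend_le (n : ℕ) : ‖blend n‖ ≤ 1 := LinearMap.mkContinuous_norm_le _ zero_le_one _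

/-- The preimage is the image of `w` under the adjoint of `blend n`: each coordinate of `w` is
distributed to the two summands with the blending weights, whose squares add up to `1`. -/
theorem exists_blend_eq (n : ℕ) (w : EuclideanSpace ℂ (Fin n)) :
    ∃ v, blend n v = w ∧ ‖v‖ ≤ ‖w‖ := by
  let a : ℕ → ℂ := fun k => if h : k < n then (√(1 - k / n) : ℝ) * w ⟨k, h⟩ else 0
  let b : ℕ → ℂ := fun k => if h : k < n then
    (√((n - 1 - k : ℕ) / n) : ℝ) * w ⟨n - 1 - k, by omega⟩ else 0
  let x : EllTwo := ∑ k ∈ Finset.range n, lp.single 2 k (a k)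
  let y : EllTwo := ∑ k ∈ Finset.range n, lp.single 2 k (b k)
  have hsum : ∀ (f : ℕ → ℂ) (k : ℕ), k < n →
      (∑ k ∈ Finset.range n, lp.single 2 k (f k) : EllTwo) k = f k := fun f k hk => by
    rw [lp.coeFn_sum, Finset.sum_apply]
    simp only [lp.coeFn_single, Finset.sum_pi_single]
    simp [hk]
  have hnorm : ∀ f : ℕ → ℂ, ‖(∑ k ∈ Finset.range n, lp.single 2 k (f k) : EllTwo)‖ ^ 2 =
      ∑ k ∈ Finset.range n, ‖f k‖ ^ 2 := fun f => by
    simpa using lp.norm_sum_single (p := 2) (E := fun _ : ℕ => ℂ) (by norm_num) f (Finset.range n)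
  refine ⟨WithLp.toLp 2 (x, y), ?_, ?_⟩
  · ext i
    have hi := i.2
    have hx : x i = (√(1 - (i : ℕ) / n) : ℝ) * w i := by
      rw [hsum a i i.2]
      simp [a]
    have hy : y (n - 1 - i) = (√((i : ℕ) / n) : ℝ) * w i := by
      have e : n - 1 - (n - 1 - (i : ℕ)) = i := by omega
      rw [hsum b _ (by omega)]
      simp only [b]
      rw [dif_pos (by omega)]
      simp only [e]
    rw [blend_apply, blendSeq]
    change (√(1 - (i : ℕ) / n) : ℝ) * x i + (√((i : ℕ) / n) : ℝ) * y (n - 1 - i) = w i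
    rw [hx, hy, ← mul_assoc, ← mul_assoc, ← add_mul, ← sq, ← sq]
    norm_cast
    rw [sq_blend_coeff hi.le (by omega)]
    simp
  · refine abs_le_of_sq_le_sq' ?_ (norm_nonneg w) |>.2
    rw [EuclideanSpace.norm_sq_eq, WithLp.prod_norm_sq_eq_of_L2]
    change ‖x‖ ^ 2 + ‖y‖ ^ 2 ≤ _
    rw [hnorm a, hnorm b, ← Finset.sum_range_reflect (fun k => ‖b k‖ ^ 2),
      ← Finset.sum_add_distrib, Finset.sum_range]
    refine Finset.sum_le_sum fun i _ => ?_
    have hi := i.2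
    have e : n - 1 - (n - 1 - (i : ℕ)) = i := by omega
    have ha : a i = (√(1 - (i : ℕ) / n) : ℝ) * w i := by simp [a]
    have hb : b (n - 1 - i) = (√((i : ℕ) / n) : ℝ) * w i := by
      simp only [b]
      rw [dif_pos (by omega)]
      simp only [e]
    rw [ha, hb, norm_mul, norm_mul, mul_pow, mul_pow, ← add_mul, Complex.norm_real,
      Complex.norm_real, Real.norm_eq_abs, Real.norm_eq_abs, sq_abs, sq_abs,
      sq_blend_coeff hi.le (by omega), one_mul]

/-- `|√s - √t|² ≤ |√s - √t| (√s + √t) = |s - t|`. This is the source of the rate `n^{-1/2}`. -/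
theorem abs_sqrt_sub_sqrt_le {s t δ : ℝ} (hs : 0 ≤ s) (ht : 0 ≤ t) (h : |s - t| ≤ δ) :
    |√s - √t| ≤ √δ := by
  refine Real.abs_le_sqrt ?_
  refine le_trans ?_ h
  have h1 : |s - t| = |√s - √t| * (√s + √t) := by
    rw [← abs_of_nonneg (by positivity : 0 ≤ √s + √t), ← abs_mul]
    congr 1
    nlinarith [Real.sq_sqrt hs, Real.sq_sqrt ht]
  rw [h1, ← sq_abs, sq]
  gcongr
  rw [abs_le]
  constructor <;> linarith [Real.sqrt_nonneg s, Real.sqrt_nonneg t]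

/-- An operator into `ℂⁿ` whose coordinates are small multiples of coordinates of two vectors
of `ℓ²` is small. -/
theorem norm_le_of_coord_le {n : ℕ} {A : EllTwoSum →L[ℂ] EuclideanSpace ℂ (Fin n)} {δ : ℝ}
    (hδ : 0 ≤ δ)
    (h : ∀ v, ∃ x y : EllTwo, ‖x‖ ≤ ‖v.fst‖ ∧ ‖y‖ ≤ ‖v.snd‖ ∧ ∀ i : Fin n, ∃ c s : ℝ,
      |c| ≤ δ ∧ |s| ≤ δ ∧ A v i = c * x i + s * y (n - 1 - i)) : ‖A‖ ≤ 2 * δ := by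
  refine ContinuousLinearMap.opNorm_le_bound _ (by positivity) fun v => ?_
  obtain ⟨x, y, hx, hy, hA⟩ := h v
  refine abs_le_of_sq_le_sq' ?_ (by positivity) |>.2
  rw [EuclideanSpace.norm_sq_eq, mul_pow, WithLp.prod_norm_sq_eq_of_L2]
  calc ∑ i, ‖A v i‖ ^ 2 ≤ ∑ i : Fin n, (2 * δ) ^ 2 * (‖x i‖ ^ 2 + ‖y (n - 1 - i)‖ ^ 2) := by
        refine Finset.sum_le_sum fun i _ => ?_
        obtain ⟨c, s, hc, hs, e⟩ := hA i
        have h1 : ‖A v i‖ ≤ δ * ‖x i‖ + δ * ‖y (n - 1 - i)‖ := by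
          rw [e]
          refine (norm_add_le _ _).trans ?_
          rw [norm_mul, norm_mul, Complex.norm_real, Complex.norm_real, Real.norm_eq_abs,
            Real.norm_eq_abs]
          gcongr
        calc ‖A v i‖ ^ 2 ≤ (δ * ‖x i‖ + δ * ‖y (n - 1 - i)‖) ^ 2 := by gcongr
          _ ≤ _ := by
            nlinarith [sq_nonneg (δ * (‖x i‖ - ‖y (n - 1 - i)‖)), sq_nonneg (δ * ‖x i‖),
              sq_nonneg (δ * ‖y (n - 1 - i)‖)]
    _ = (2 * δ) ^ 2 * ∑ i : Fin n, (‖x i‖ ^ 2 + ‖y (n - 1 - i)‖ ^ 2) := by rw [Finset.mul_sum]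
    _ ≤ (2 * δ) ^ 2 * (‖v.fst‖ ^ 2 + ‖v.snd‖ ^ 2) := by
        refine mul_le_mul_of_nonneg_left ((sum_fin_sq_le n x y).trans ?_) (by positivity)
        gcongr

/-- A matrix as an operator on Euclidean space. -/
abbrev matOp {n : ℕ} : Matrix (Fin n) (Fin n) ℂ →⋆ₐ[ℂ]
    (EuclideanSpace ℂ (Fin n) →L[ℂ] EuclideanSpace ℂ (Fin n)) :=
  (Matrix.toEuclideanCLM (n := Fin n) (𝕜 := ℂ) : _ →⋆ₐ[ℂ] _)

theorem blend_coeff_diff {n : ℕ} (i : ℕ) (hi : i + 1 ≤ n) :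
    |√(1 - ((i + 1 : ℕ) : ℝ) / n) - √(1 - (i : ℝ) / n)| ≤ √(1 / n) ∧
      |√(((i + 1 : ℕ) : ℝ) / n) - √((i : ℝ) / n)| ≤ √(1 / n) := by
  have hn : (0 : ℝ) < n := by exact_mod_cast (by omega : 0 < n)
  have h1 : ((i : ℝ) + 1) / n ≤ 1 := by
    rw [div_le_one hn]
    exact_mod_cast hi
  have h2 : ((i : ℝ) + 1) / n - i / n = 1 / n := by ring
  have h3 : (0 : ℝ) < 1 / n := by positivity
  push_cast
  constructor <;> refine abs_sqrt_sub_sqrt_le ?_ ?_ ?_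
  · linarith
  · linarith
  · rw [abs_le]; constructor <;> linarith
  · positivity
  · positivity
  · rw [abs_le]; constructor <;> linarith

/-- In coordinate `i` both compositions read the entries `i - 1` and `n - i` of the two summands;
only the weights differ, being those of `i` and of `i - 1`. -/
theorem norm_blend_comp_shift_sub_le (n : ℕ) :
    ‖blend n ∘L shiftSumAdjoint - matOp (truncShift n) ∘L blend n‖ ≤ 2 * √(1 / n) := by
  refine norm_le_of_coord_le (Real.sqrt_nonneg _) fun v =>
    ⟨unilateralShift v.fst, backwardShift v.snd, norm_unilateralShift_apply_le _,
      norm_backwardShift_apply_le _, fun i => ?_⟩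
  have hA : (blend n ∘L shiftSumAdjoint - matOp (truncShift n) ∘L blend n) v i =
      ((√(1 - (i : ℕ) / n) : ℝ) * unilateralShift v.fst i +
        (√((i : ℕ) / n) : ℝ) * backwardShift v.snd (n - 1 - i)) - shiftSeq (blendSeq n v) i := by
    rw [← truncShift_mulVec (blendSeq n v) (blend_apply n v) i]
    rfl
  rw [hA]
  rcases i with ⟨_ | i, hi⟩
  -- At the left end there is no error: `S` produces a zero, and the weight `√(0 / n)` removes the
  -- second summand.
  · refine ⟨0, 0, by simp, by simp, ?_⟩
    simp [shiftSeq, unilateralShift_apply]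
  · have hd := blend_coeff_diff i hi.le
    refine ⟨_, _, hd.1, hd.2, ?_⟩
    simp only [shiftSeq, blendSeq, unilateralShift_apply, backwardShift_apply]
    rw [show n - 1 - (i + 1) + 1 = n - 1 - i by omega]
    push_cast
    ring

theorem norm_blend_comp_star_shift_sub_le (n : ℕ) :
    ‖blend n ∘L star shiftSumAdjoint - matOp (star (truncShift n)) ∘L blend n‖ ≤
      2 * √(1 / n) := by
  refine norm_le_of_coord_le (Real.sqrt_nonneg _) fun v =>
    ⟨backwardShift v.fst, unilateralShift v.snd, norm_backwardShift_apply_le _,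
      norm_unilateralShift_apply_le _, fun i => ?_⟩
  have hA : (blend n ∘L star shiftSumAdjoint - matOp (star (truncShift n)) ∘L blend n) v i =
      ((√(1 - (i : ℕ) / n) : ℝ) * backwardShift v.fst i +
        (√((i : ℕ) / n) : ℝ) * unilateralShift v.snd (n - 1 - i)) -
        if (i : ℕ) + 1 < n then blendSeq n v (i + 1) else 0 := by
    rw [← truncShift_conjTranspose_mulVec (blendSeq n v) (blend_apply n v) i]
    change blend n (star shiftSumAdjoint v) i - _ = _
    rw [star_shiftSumAdjoint_apply]
    rfl
  have hi := i.2
  have hd := blend_coeff_diff (n := n) i hi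
  rw [abs_sub_comm, abs_sub_comm (√(((i : ℕ) + 1 : ℕ) / n))] at hd
  refine ⟨_, _, hd.1, hd.2, ?_⟩
  rw [hA]
  split_ifs with h
  · have e : n - 1 - (i : ℕ) = (n - 1 - (i + 1)) + 1 := by omega
    rw [e]
    simp only [shiftSeq, blendSeq, unilateralShift_apply, backwardShift_apply]
    push_cast
    ring
  -- At the right end `S_n*` produces `0`. The same weight differences still work, since `√(1 - n /
  -- n) = 0` and coordinate `0` of the shifted second summand vanishes.
  · have hn : (i : ℕ) + 1 = n := by omega
    have hn0 : (n : ℝ) ≠ 0 := by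
      have : n ≠ 0 := by omega
      exact_mod_cast this
    have e : n - 1 - (i : ℕ) = 0 := by omega
    rw [e, hn]
    simp [shiftSeq, unilateralShift_apply, hn0]

end Shifts

/-! ### Convergence of the truncated shifts to `S ⊕ S*` -/

section ShiftHom

open Filter Topology

theorem tendsto_natCast_div_atTop (i : ℕ) : Tendsto (fun n : ℕ => (i : ℝ) / n) atTop (𝓝 0) :=
  tendsto_const_nhds.div_atTop tendsto_natCast_atTop_atTop

theorem tendsto_sqrt_div (i : ℕ) : Tendsto (fun n : ℕ => √((i : ℝ) / n)) atTop (𝓝 0) := by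
  simpa using (tendsto_natCast_div_atTop i).sqrt

theorem tendsto_sqrt_one_sub_div (i : ℕ) :
    Tendsto (fun n : ℕ => √(1 - (i : ℝ) / n)) atTop (𝓝 1) := by
  simpa using (tendsto_const_nhds (x := (1 : ℝ))|>.sub (tendsto_natCast_div_atTop i)).sqrt

theorem tendsto_ofReal_mul_of_bounded {c : ℕ → ℝ} (hc : Tendsto c atTop (𝓝 0)) {x : EllTwo}
    (k : ℕ → ℕ) : Tendsto (fun n => (c n : ℂ) * x (k n)) atTop (𝓝 0) := by
  have h : Tendsto (fun n => |c n| * ‖x‖) atTop (𝓝 0) := by simpa using hc.abs.mul_const ‖x‖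
  refine squeeze_zero_norm (fun n => ?_) h
  rw [norm_mul, Complex.norm_real, Real.norm_eq_abs]
  exact mul_le_mul_of_nonneg_left (lp.norm_apply_le_norm two_ne_zero x _) (abs_nonneg _)

theorem tendsto_blendSeq (v : EllTwoSum) (i : ℕ) :
    Tendsto (fun n => blendSeq n v i) atTop (𝓝 (v.fst i)) := by
  have h1 := ((Complex.continuous_ofReal.tendsto 1).comp (tendsto_sqrt_one_sub_div i)).mul_const
    (v.fst i)
  have h2 := tendsto_ofReal_mul_of_bounded (tendsto_sqrt_div i) (x := v.snd) (fun n => n - 1 - i)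
  simpa [blendSeq] using h1.add h2

theorem tendsto_blendSeq_reflect (v : EllTwoSum) (i : ℕ) :
    Tendsto (fun n => blendSeq n v (n - 1 - i)) atTop (𝓝 (v.snd i)) := by
  have h1 := tendsto_ofReal_mul_of_bounded (tendsto_sqrt_div (i + 1)) (x := v.fst)
    (fun n => n - 1 - i)
  have h2 := ((Complex.continuous_ofReal.tendsto 1).comp
    (tendsto_sqrt_one_sub_div (i + 1))).mul_const (v.snd i)
  have h := h1.add h2
  simp only [zero_add, Complex.ofReal_one, one_mul] at h
  refine h.congr' ?_
  filter_upwards [eventually_ge_atTop (i + 1)] with n hn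
  have hn0 : (n : ℝ) ≠ 0 := by
    have : n ≠ 0 := by omega
    exact_mod_cast this
  have e : ((n - 1 - i : ℕ) : ℝ) = n - (i + 1 : ℕ) := by
    rw [Nat.sub_sub, Nat.cast_sub (by omega)]
    push_cast
    ring
  have e2 : n - 1 - (n - 1 - i) = i := by omega
  rw [blendSeq, e, e2, sub_div, div_self hn0]
  simp

/-- The first `M` coordinates of `blend n v` converge to those of `v.fst`, the last `M` to those of
`v.snd`. For `n ≥ 2 M` the two groups are disjoint, so both count towards the norm. -/
theorem eventually_le_norm_blend (v : EllTwoSum) {ε : ℝ} (hε : 0 < ε) :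
    ∀ᶠ n in atTop, ‖v‖ - ε ≤ ‖blend n v‖ := by
  rcases le_or_gt ‖v‖ ε with h | h
  · exact Eventually.of_forall fun n => (sub_nonpos.2 h).trans (norm_nonneg _)
  have hsum : HasSum (fun i => ‖v.fst i‖ ^ 2 + ‖v.snd i‖ ^ 2) (‖v‖ ^ 2) := by
    rw [WithLp.prod_norm_sq_eq_of_L2]
    have h1 := lp.hasSum_norm (p := 2) (by norm_num) v.fst
    have h2 := lp.hasSum_norm (p := 2) (by norm_num) v.snd
    simpa using h1.add h2
  have hlt : (‖v‖ - ε) ^ 2 < ‖v‖ ^ 2 := by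
    have := norm_nonneg v
    nlinarith
  obtain ⟨M, hM⟩ := (hsum.tendsto_sum_nat.eventually_const_lt hlt).exists
  have hlim : Tendsto (fun n => ∑ i ∈ Finset.range M,
      (‖blendSeq n v i‖ ^ 2 + ‖blendSeq n v (n - 1 - i)‖ ^ 2)) atTop
      (𝓝 (∑ i ∈ Finset.range M, (‖v.fst i‖ ^ 2 + ‖v.snd i‖ ^ 2))) :=
    tendsto_finsetSum _ fun i _ =>
      ((tendsto_blendSeq v i).norm.pow 2).add ((tendsto_blendSeq_reflect v i).norm.pow 2)
  filter_upwards [hlim.eventually_const_lt hM, eventually_ge_atTop (2 * M)] with n hn hMn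
  refine abs_le_of_sq_le_sq' (hn.le.trans ?_) (norm_nonneg _) |>.2
  rw [EuclideanSpace.norm_sq_eq]
  simp_rw [blend_apply]
  rw [← Finset.sum_range fun i => ‖blendSeq n v i‖ ^ 2, Finset.sum_add_distrib,
    ← Finset.sum_image (s := Finset.range M) (g := fun i => n - 1 - i)
      (f := fun i => ‖blendSeq n v i‖ ^ 2), ← Finset.sum_union]
  · refine Finset.sum_le_sum_of_subset_of_nonneg (fun i hi => ?_) fun _ _ _ => by positivity
    simp only [Finset.mem_union, Finset.mem_image, Finset.mem_range] at hi ⊢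
    omega
  · rw [Finset.disjoint_left]
    intro i hi hi'
    simp only [Finset.mem_image, Finset.mem_range] at hi hi'
    omega
  · intro i hi j hj h
    simp only [Finset.coe_range, Set.mem_Iio] at hi hj h
    omega

/-- The coordinate representations of a product of matrix algebras. -/
def matProdOp {X : Set ℕ+} (n : X) : MatProd X →⋆ₐ[ℂ]
    (EuclideanSpace ℂ (Fin (n : ℕ+)) →L[ℂ] EuclideanSpace ℂ (Fin (n : ℕ+))) :=
  matOp.comp (matProdEval n)

theorem tendsto_index_cofinite (X : Set ℕ+) :
    Tendsto (fun n : X => ((n : ℕ+) : ℕ)) cofinite atTop := by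
  rw [← Nat.cofinite_eq_atTop]
  exact (PNat.coe_injective.comp Subtype.val_injective).tendsto_cofinite

theorem tendsto_sqrt_inv_index (X : Set ℕ+) (C : ℝ) :
    Tendsto (fun n : X => C * √(1 / ((n : ℕ+) : ℕ))) cofinite (𝓝 0) := by
  have h := ((tendsto_sqrt_div 1).const_mul C).comp (tendsto_index_cofinite X)
  simpa [Function.comp_def] using h

theorem matProdOp_truncShiftSum {X : Set ℕ+} (n : X) :
    matProdOp n (truncShiftSum X) = matOp (truncShift (n : ℕ+)) := rfl

theorem matProdOp_star_truncShiftSum {X : Set ℕ+} (n : X) :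
    matProdOp n (star (truncShiftSum X)) = matOp (star (truncShift (n : ℕ+))) := rfl

/-- Maps which intertwine the truncated shifts up to `O(n^{-1/2})` intertwine asymptotically. -/
theorem asympIntertwines_of_le {X : Set ℕ+} {H : Type*} [NormedAddCommGroup H]
    [InnerProductSpace ℂ H] [CompleteSpace H]
    (G : ∀ n : X, H →L[ℂ] EuclideanSpace ℂ (Fin (n : ℕ+))) (hG : ∀ n, ‖G n‖ ≤ 1)
    {b : H →L[ℂ] H} {C : ℝ}
    (h : ∀ n, ‖G n ∘L b - matOp (truncShift (n : ℕ+)) ∘L G n‖ ≤ C * √(1 / ((n : ℕ+) : ℕ)))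
    (h' : ∀ n, ‖G n ∘L star b - matOp (star (truncShift (n : ℕ+))) ∘L G n‖ ≤
      C * √(1 / ((n : ℕ+) : ℕ)))
    {y : MatProd X × (H →L[ℂ] H)} (hy : y ∈ jointGen (truncShiftSum X) b) :
    AsympIntertwines cofinite G matProdOp y := by
  refine AsympIntertwines.of_mem_jointGen hG ?_ ?_ hy
  · refine squeeze_zero (fun _ => norm_nonneg _) (fun n => ?_) (tendsto_sqrt_inv_index X C)
    rw [matProdOp_truncShiftSum]
    exact h n
  · refine squeeze_zero (fun _ => norm_nonneg _) (fun n => ?_) (tendsto_sqrt_inv_index X C)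
    rw [matProdOp_star_truncShiftSum]
    exact h' n

theorem asympIntertwines_blend {X : Set ℕ+} {y : MatProd X × (EllTwoSum →L[ℂ] EllTwoSum)}
    (hy : y ∈ jointGen (truncShiftSum X) shiftSumAdjoint) :
    AsympIntertwines cofinite (fun n : X => blend (n : ℕ+)) matProdOp y :=
  asympIntertwines_of_le _ (fun _ => norm_blend_le _)
    (fun n => norm_blend_comp_shift_sub_le (n : ℕ+))
    (fun n => norm_blend_comp_star_shift_sub_le (n : ℕ+)) hy

/-- For infinite `X`, the truncated shifts converge to `S ⊕ S*`. -/
theorem exists_shiftHom (X : Set ℕ+) [Infinite X] :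
    ∃ σ : CStarGen (truncShiftSum X) →⋆ₐ[ℂ] CStarGen shiftSumAdjoint,
      σ (CStarGen.gen _) = CStarGen.gen _ ∧
      ∀ (x : CStarGen (truncShiftSum X)) (ε : ℝ), 0 < ε →
        ∀ᶠ n in cofinite, ‖CStarGen.incl _ x n‖ ≤ ‖σ x‖ + ε := by
  obtain ⟨σ, h1, h2⟩ := exists_elemental_hom (T := truncShiftSum X) (T' := shiftSumAdjoint)
    fun y hy => (asympIntertwines_blend hy).norm_snd_le (fun n => norm_blend_le _)
      (fun v ε hε => (tendsto_index_cofinite X).eventually (eventually_le_norm_blend v hε))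
      (Eventually.of_forall fun n => NonUnitalStarAlgHom.norm_apply_le (matProdOp n) y.1)
  exact ⟨σ, h1, fun x ε hε => (asympIntertwines_blend (h2 x)).eventually_norm_fst_le
    (fun n w => exists_blend_eq _ w) (fun n => norm_blend_le _) hε⟩

/-! ### Characters -/

/-- The approximate eigenvector of the truncated shift for `ω`. -/
def eigenMap (ω : ℂ) (n : ℕ) : ℂ →L[ℂ] EuclideanSpace ℂ (Fin n) :=
  (ContinuousLinearMap.id ℂ ℂ).smulRight
    (WithLp.toLp 2 fun i : Fin n => (√(1 / n) : ℝ) * star ω ^ (i : ℕ))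

theorem eigenMap_apply (ω : ℂ) (n : ℕ) (z : ℂ) (i : Fin n) :
    eigenMap ω n z i = z * ((√(1 / n) : ℝ) * star ω ^ (i : ℕ)) := rfl

theorem norm_eigenMap_apply {ω : ℂ} (hω : ‖ω‖ = 1) {n : ℕ} (hn : 0 < n) (z : ℂ) :
    ‖eigenMap ω n z‖ = ‖z‖ := by
  rw [← sq_eq_sq₀ (norm_nonneg _) (norm_nonneg _), EuclideanSpace.norm_sq_eq]
  simp_rw [eigenMap_apply, norm_mul, norm_pow, norm_star, hω, one_pow, mul_one, mul_pow,
    Complex.norm_real, Real.norm_eq_abs, sq_abs]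
  rw [Finset.sum_const, Real.sq_sqrt (by positivity)]
  have : (n : ℝ) ≠ 0 := by positivity
  simp
  field_simp

theorem norm_le_of_support_singleton {n : ℕ} {w : EuclideanSpace ℂ (Fin n)} {k : ℕ} {c : ℝ}
    (hc : 0 ≤ c) (h : ∀ i : Fin n, ‖w i‖ ≤ if (i : ℕ) = k then c else 0) : ‖w‖ ≤ c := by
  refine abs_le_of_sq_le_sq' ?_ hc |>.2
  rw [EuclideanSpace.norm_sq_eq]
  by_cases hk : k < n
  · rw [Finset.sum_eq_single (⟨k, hk⟩ : Fin n)]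
    · have := h ⟨k, hk⟩
      rw [if_pos rfl] at this
      gcongr
    · intro i _ hi
      have := h i
      rw [if_neg fun e => hi (Fin.ext e)] at this
      simp [norm_le_zero_iff.1 this]
    · simp
  · rw [Finset.sum_eq_zero]
    · positivity
    · intro i _
      have := h i
      rw [if_neg fun e => hk (by omega)] at this
      simp [norm_le_zero_iff.1 this]

/-- The scalar `ω` as an operator on `ℂ`. -/
abbrev scalarOp (ω : ℂ) : ℂ →L[ℂ] ℂ := algebraMap ℂ (ℂ →L[ℂ] ℂ) ω

/-- The vector with entries `n^{-1/2} ω̄ⁱ` satisfies the eigenvalue equation for `ω` except in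
coordinate `0`. For the adjoint, the exception is the last coordinate. -/
theorem norm_eigenMap_comp_sub_le {ω : ℂ} (hω : ‖ω‖ = 1) (n : ℕ) :
    ‖eigenMap ω n ∘L scalarOp ω - matOp (truncShift n) ∘L eigenMap ω n‖ ≤ 1 * √(1 / n) := by
  have hω' : ω * star ω = 1 := by
    have := Complex.mul_conj ω
    rw [Complex.normSq_eq_norm_sq, hω] at this
    simpa using this
  refine ContinuousLinearMap.opNorm_le_bound _ (by positivity) fun z => ?_
  refine norm_le_of_support_singleton (k := 0) (by positivity) fun i => ?_
  have hA : (eigenMap ω n ∘L scalarOp ω - matOp (truncShift n) ∘L eigenMap ω n) z i =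
      ω * z * ((√(1 / n) : ℝ) * star ω ^ (i : ℕ)) -
        shiftSeq (fun i => z * ((√(1 / n) : ℝ) * star ω ^ i)) i := by
    rw [← truncShift_mulVec _ (eigenMap_apply ω n z) i]
    rfl
  rw [hA]
  rcases i with ⟨_ | i, hi⟩
  · simp [shiftSeq, hω]
    rw [abs_of_nonneg (by positivity), mul_comm]
  · simp only [shiftSeq]
    rw [if_neg (by omega)]
    refine le_of_eq (norm_eq_zero.2 ?_)
    rw [pow_succ]
    linear_combination z * (√(1 / n) : ℝ) * star ω ^ i * hω'

theorem norm_eigenMap_comp_star_sub_le {ω : ℂ} (hω : ‖ω‖ = 1) (n : ℕ) :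
    ‖eigenMap ω n ∘L star (scalarOp ω) - matOp (star (truncShift n)) ∘L eigenMap ω n‖ ≤
      1 * √(1 / n) := by
  have hs : star (scalarOp ω) = scalarOp (star ω) := (algebraMap_star_comm ω).symm
  refine ContinuousLinearMap.opNorm_le_bound _ (by positivity) fun z => ?_
  refine norm_le_of_support_singleton (k := n - 1) (by positivity) fun i => ?_
  have hA : (eigenMap ω n ∘L star (scalarOp ω) - matOp (star (truncShift n)) ∘L eigenMap ω n) z i =
      star ω * z * ((√(1 / n) : ℝ) * star ω ^ (i : ℕ)) -
        if (i : ℕ) + 1 < n then z * ((√(1 / n) : ℝ) * star ω ^ ((i : ℕ) + 1)) else 0 := by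
    rw [← truncShift_conjTranspose_mulVec
      (fun i => z * ((√(1 / n) : ℝ) * star ω ^ i)) (eigenMap_apply ω n z) i, hs]
    rfl
  rw [hA]
  have hi := i.2
  split_ifs with h1 h2 h2
  · omega
  · refine le_of_eq (norm_eq_zero.2 ?_)
    ring
  · simp [hω]
    rw [abs_of_nonneg (by positivity), mul_comm]
  · omega

/-- The eigenvectors are approximate as `n → ∞`, so the character depends only on the coordinates at
infinity. This is what lets it descend to `C*(S ⊕ S*)`. -/
theorem exists_characterHom (X : Set ℕ+) [Infinite X] {ω : ℂ} (hω : ‖ω‖ = 1) :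
    ∃ χ : CStarGen (truncShiftSum X) →⋆ₐ[ℂ] CStarGen (scalarOp ω),
      χ (CStarGen.gen _) = CStarGen.gen _ ∧
      ∀ (x : CStarGen (truncShiftSum X)) (c : ℝ),
        (∀ᶠ n in cofinite, ‖CStarGen.incl _ x n‖ ≤ c) → ‖χ x‖ ≤ c := by
  have hnorm : ∀ (n : X) z, ‖eigenMap ω (n : ℕ+) z‖ = ‖z‖ := fun n z =>
    norm_eigenMap_apply hω (n : ℕ+).pos z
  have hG : ∀ n : X, ‖eigenMap ω (n : ℕ+)‖ ≤ 1 := fun n =>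
    ContinuousLinearMap.opNorm_le_bound _ zero_le_one fun z => by rw [hnorm, one_mul]
  have hy : ∀ y ∈ jointGen (truncShiftSum X) (scalarOp ω),
      AsympIntertwines cofinite (fun n : X => eigenMap ω (n : ℕ+)) matProdOp y := fun y hy =>
    asympIntertwines_of_le _ hG (fun n => norm_eigenMap_comp_sub_le hω (n : ℕ+))
      (fun n => norm_eigenMap_comp_star_sub_le hω (n : ℕ+)) hy
  have hv : ∀ z : ℂ, ∀ ε > 0, ∀ᶠ n : X in cofinite, ‖z‖ - ε ≤ ‖eigenMap ω (n : ℕ+) z‖ :=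
    fun z ε hε => Eventually.of_forall fun n => by rw [hnorm]; linarith
  obtain ⟨χ, h1, h2⟩ := exists_elemental_hom (T := truncShiftSum X) (T' := scalarOp ω)
    fun y hym => (hy y hym).norm_snd_le hG hv
      (Eventually.of_forall fun n => NonUnitalStarAlgHom.norm_apply_le (matProdOp n) y.1)
  exact ⟨χ, h1, fun x c hc => (hy _ (h2 x)).norm_snd_le hG hv hc⟩

end ShiftHom

/-! ### The covers -/

section ShiftCovers

open Filter Topology Polynomial

theorem matNorm_aeval_gen {D : Type*} [CStarAlgebra D] (T : D) {n : ℕ}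
    (P : Matrix (Fin n) (Fin n) ℂ[X]) :
    matNorm (P.map fun p => aeval (CStarGen.gen T) p) = matNorm (P.map fun p => aeval T p) := by
  rw [← matNorm_map_of_injective (CStarGen.incl T : CStarGen T →⋆ₙₐ[ℂ] D)
    (CStarGen.incl_injective T)]
  congr 1
  ext1 i j
  exact (aeval_algHom_apply (CStarGen.incl T).toAlgHom (CStarGen.gen T) (P i j)).symm

theorem matNorm_aeval_le_of_hom {D D' : Type*} [CStarAlgebra D] [CStarAlgebra D'] {T : D} {T' : D'}
    {φ : CStarGen T →⋆ₙₐ[ℂ] CStarGen T'}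
    (h : ∀ p : ℂ[X], φ (aeval (CStarGen.gen T) p) = aeval (CStarGen.gen T') p) {n : ℕ}
    (P : Matrix (Fin n) (Fin n) ℂ[X]) :
    matNorm (P.map fun p => aeval T' p) ≤ matNorm (P.map fun p => aeval T p) := by
  rw [← matNorm_aeval_gen T', ← matNorm_aeval_gen T]
  refine le_of_eq_of_le ?_ (matNorm_map_le φ (P.map fun p => aeval (CStarGen.gen T) p))
  congr 1
  ext1 i j
  exact (h _).symm

theorem matNorm_aeval_scalarOp (ω : ℂ) {n : ℕ} (P : Matrix (Fin n) (Fin n) ℂ[X]) :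
    matNorm (P.map fun p => aeval (scalarOp ω) p) = matNorm (P.map fun p => p.eval ω) := by
  let φ : ℂ →⋆ₐ[ℂ] (ℂ →L[ℂ] ℂ) :=
    { Algebra.ofId ℂ (ℂ →L[ℂ] ℂ) with map_star' := fun z => algebraMap_star_comm z }
  have hφ : Function.Injective φ := (algebraMap ℂ (ℂ →L[ℂ] ℂ)).injective
  rw [← matNorm_map_of_injective (φ : ℂ →⋆ₙₐ[ℂ] (ℂ →L[ℂ] ℂ)) hφ]
  congr 1
  ext1 i j
  exact aeval_algebraMap_apply_eq_algebraMap_eval ω (P i j)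

/-- Characters at all points of the circle bound the norm from below there, and by the maximum
modulus principle on the whole disc. -/
theorem isPolyCompletelyIsometric_of_characters {D : Type*} [CStarAlgebra D] {T : D}
    (h1 : ∀ (n : ℕ) (P : Matrix (Fin n) (Fin n) ℂ[X]),
      matNorm (P.map fun p => aeval T p) ≤ matNorm (P.map fun p => aeval discCoord p))
    (h2 : ∀ ω : ℂ, ‖ω‖ = 1 → ∃ χ : CStarGen T →⋆ₙₐ[ℂ] CStarGen (scalarOp ω),
        ∀ p : ℂ[X], χ (aeval (CStarGen.gen T) p) = aeval (CStarGen.gen (scalarOp ω)) p) :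
    IsPolyCompletelyIsometric T := by
  refine fun n P => (h1 n P).antisymm (matNorm_aeval_discCoord_le P fun ω hω => ?_)
  obtain ⟨χ, hχ⟩ := h2 ω hω
  rw [← matNorm_aeval_scalarOp]
  exact matNorm_aeval_le_of_hom hχ P

theorem starAlgHom_aeval_gen {D D' : Type*} [CStarAlgebra D] [CStarAlgebra D'] {T : D} {T' : D'}
    {φ : CStarGen T →⋆ₐ[ℂ] CStarGen T'} (h : φ (CStarGen.gen T) = CStarGen.gen T') (p : ℂ[X]) :
    φ (aeval (CStarGen.gen T) p) = aeval (CStarGen.gen T') p := by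
  rw [← h]
  exact (aeval_algHom_apply φ.toAlgHom (CStarGen.gen T) p).symm

theorem isPolyCompletelyIsometric_truncShiftSum (X : Set ℕ+) [Infinite X] :
    IsPolyCompletelyIsometric (truncShiftSum X) := by
  refine isPolyCompletelyIsometric_of_characters
    (fun n P => matNorm_aeval_truncShiftSum_le X P) fun ω hω => ?_
  obtain ⟨χ, hχ, -⟩ := exists_characterHom X hω
  exact ⟨χ, starAlgHom_aeval_gen hχ⟩

/-- A homomorphism on `C*(⊕ S_n)` which is asymptotically dominated by the coordinates factors
through `C*(S ⊕ S*)`. -/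
theorem exists_factor_shiftHom (X : Set ℕ+) [Infinite X] {B : Type*} [NonUnitalCStarAlgebra B]
    (π : CStarGen (truncShiftSum X) →⋆ₙₐ[ℂ] B)
    (hπ : ∀ (x : CStarGen (truncShiftSum X)) (c : ℝ),
      (∀ᶠ n in cofinite, ‖CStarGen.incl _ x n‖ ≤ c) → ‖π x‖ ≤ c) :
    ∃ ψ : CStarGen shiftSumAdjoint →⋆ₙₐ[ℂ] B, ∀ p : ℂ[X],
      ψ (aeval (CStarGen.gen shiftSumAdjoint) p) = π (aeval (CStarGen.gen (truncShiftSum X)) p) := by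
  obtain ⟨σ, hσ, hn⟩ := exists_shiftHom X
  have hd : DenseRange σ := denseRange_of_gen_mem σ ⟨_, hσ⟩
  obtain ⟨ψ, hψ⟩ := exists_nonUnitalStarAlgHom_of_norm_le
    (σ : CStarGen (truncShiftSum X) →⋆ₙₐ[ℂ] CStarGen shiftSumAdjoint) π hd fun x =>
      le_of_forall_pos_le_add fun ε hε => hπ x _ (hn x ε hε)
  refine ⟨ψ, fun p => ?_⟩
  rw [← starAlgHom_aeval_gen hσ]
  exact hψ _

/-- The upper bound and the characters are both transported from `C*(⊕ S_n)` over all `n`: the first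
along the map onto `S ⊕ S*`, the second by factoring through it. -/
theorem isPolyCompletelyIsometric_shiftSumAdjoint :
    IsPolyCompletelyIsometric shiftSumAdjoint := by
  have : Infinite (Set.univ : Set ℕ+) := Set.infinite_univ.to_subtype
  refine isPolyCompletelyIsometric_of_characters (fun n P => ?_) fun ω hω => ?_
  · obtain ⟨σ, hσ, -⟩ := exists_shiftHom Set.univ
    exact (matNorm_aeval_le_of_hom
      (φ := (σ : CStarGen (truncShiftSum Set.univ) →⋆ₙₐ[ℂ] CStarGen shiftSumAdjoint))
      (starAlgHom_aeval_gen hσ) P).trans (matNorm_aeval_truncShiftSum_le Set.univ P)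
  · obtain ⟨χ, hχ, hn⟩ := exists_characterHom Set.univ hω
    obtain ⟨ψ, hψ⟩ := exists_factor_shiftHom Set.univ
      (χ : CStarGen (truncShiftSum Set.univ) →⋆ₙₐ[ℂ] CStarGen (scalarOp ω)) hn
    exact ⟨ψ, fun p => (hψ p).trans (starAlgHom_aeval_gen hχ p)⟩

end ShiftCovers

/-! ### The elements separating the truncated shifts -/

section Gap

open Filter Topology Polynomial

/-- The element `(1 - T T*) T*ᵏ (1 - T* T)`. -/
def gapElement {D : Type*} [Ring D] [StarRing D] (T : D) (k : ℕ) : D :=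
  (1 - T * star T) * star (T ^ k) * (1 - star T * T)

theorem map_gapElement {D D' : Type*} [CStarAlgebra D] [CStarAlgebra D'] (φ : D →⋆ₐ[ℂ] D')
    (T : D) (k : ℕ) : φ (gapElement T k) = gapElement (φ T) k := by
  simp [gapElement, map_star]

/-- The element `(1 - T T*) T*ᵏ (1 - T* T)` of a cover of the disc algebra with `T` the image
of `z`. -/
def CStarCover.gap (B : CStarCover.{u} discAlgebra) (k : ℕ) : B.alg :=
  (B.ι (polyDisc 1) - B.ι (polyDisc X) * star (B.ι (polyDisc X))) * star (B.ι (polyDisc (X ^ k))) *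
    (B.ι (polyDisc 1) - star (B.ι (polyDisc X)) * B.ι (polyDisc X))

theorem CStarCover.map_gap {B C : CStarCover.{u} discAlgebra} {π : C.alg →⋆ₙₐ[ℂ] B.alg}
    (h : ∀ a, π (C.ι a) = B.ι a) (k : ℕ) : π (C.gap k) = B.gap k := by
  simp [CStarCover.gap, map_star, h]

theorem IsPolyCompletelyIsometric.cover_gap {D : Type u} [CStarAlgebra D] {T : D}
    (hT : IsPolyCompletelyIsometric T) (k : ℕ) :
    hT.cover.gap k = gapElement (CStarGen.gen T) k := by
  rw [CStarCover.gap, hT.cover_ι_poly, hT.cover_ι_poly, hT.cover_ι_poly, map_one, map_pow, aeval_X]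
  rfl

theorem one_sub_truncShift_mul_star (n : ℕ) : 1 - truncShift n * star (truncShift n) =
    Matrix.diagonal fun i : Fin n => if (i : ℕ) = 0 then (1 : ℂ) else 0 := by
  ext i j
  rw [Matrix.sub_apply, Matrix.star_eq_conjTranspose, Matrix.mul_apply]
  rcases i with ⟨_ | i, hi⟩
  · rw [Finset.sum_eq_zero]
    · simp [Matrix.one_apply, Matrix.diagonal_apply]
    · intro m _
      simp [truncShift]
  · rw [Finset.sum_eq_single (⟨i, by omega⟩ : Fin n)]
    · simp only [Matrix.one_apply, Matrix.diagonal_apply, Matrix.conjTranspose_apply, truncShift,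
        Matrix.of_apply, Fin.ext_iff]
      by_cases h : (j : ℕ) = i + 1
      · simp [h]
      · simp [h, Ne.symm h]
    · intro m _ hm
      have hm' : i ≠ (m : ℕ) := fun e => hm (Fin.ext e.symm)
      simp [truncShift, hm']
    · simp

theorem one_sub_star_truncShift_mul (n : ℕ) : 1 - star (truncShift n) * truncShift n =
    Matrix.diagonal fun i : Fin n => if (i : ℕ) + 1 = n then (1 : ℂ) else 0 := by
  ext i j
  rw [Matrix.sub_apply, Matrix.star_eq_conjTranspose, Matrix.mul_apply]
  by_cases hi : (i : ℕ) + 1 < n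
  · rw [Finset.sum_eq_single (⟨i + 1, hi⟩ : Fin n)]
    · simp only [Matrix.one_apply, Matrix.diagonal_apply, Matrix.conjTranspose_apply, truncShift,
        Matrix.of_apply, Fin.ext_iff, hi.ne]
      by_cases h : (i : ℕ) = j <;> simp [h]
    · intro m _ hm
      have hm' : (m : ℕ) ≠ i + 1 := fun e => hm (Fin.ext e)
      simp [truncShift, hm']
    · simp
  · have hi' : (i : ℕ) + 1 = n := by omega
    rw [Finset.sum_eq_zero]
    · simp [Matrix.one_apply, Matrix.diagonal_apply, hi']
    · intro m _
      have hm' : (m : ℕ) ≠ i + 1 := fun e => hi (e ▸ m.2)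
      simp [truncShift, hm']

/-- The outer factors are the projections onto the first and the last basis vector, and `S_n*ᵏ`
moves the last one to the first exactly when `n = k + 1`. -/
theorem gapElement_truncShift_apply (n k : ℕ) (i j : Fin n) : gapElement (truncShift n) k i j =
    if (i : ℕ) = 0 ∧ (j : ℕ) = k ∧ k + 1 = n then 1 else 0 := by
  rw [gapElement, one_sub_truncShift_mul_star, one_sub_star_truncShift_mul, Matrix.mul_diagonal,
    Matrix.diagonal_mul, Matrix.star_eq_conjTranspose, Matrix.conjTranspose_apply,
    truncShift_pow_apply]
  by_cases h1 : (i : ℕ) = 0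
  · by_cases h2 : (j : ℕ) = k
    · simp [h1, h2]
    · simp [h1, h2]
  · simp [h1]

theorem gapElement_truncShift_of_ne {n k : ℕ} (h : k + 1 ≠ n) :
    gapElement (truncShift n) k = 0 := by
  ext i j
  simp [gapElement_truncShift_apply, h]

theorem gapElement_truncShift_ne_zero (k : ℕ) : gapElement (truncShift (k + 1)) k ≠ 0 := by
  intro h
  have := congrFun (congrFun h 0) (Fin.last k)
  rw [gapElement_truncShift_apply] at this
  simp at this

theorem gapElement_truncShift_mul_star (k : ℕ) :
    gapElement (truncShift (k + 1)) k * star (gapElement (truncShift (k + 1)) k) =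
      1 - truncShift (k + 1) * star (truncShift (k + 1)) := by
  rw [one_sub_truncShift_mul_star]
  ext i j
  rw [Matrix.star_eq_conjTranspose, Matrix.mul_apply, Finset.sum_eq_single (Fin.last k)]
  · rw [Matrix.conjTranspose_apply, gapElement_truncShift_apply, gapElement_truncShift_apply,
      Matrix.diagonal_apply]
    simp only [Fin.val_last, and_true, Fin.ext_iff]
    by_cases hi : (i : ℕ) = 0
    · by_cases hj : (j : ℕ) = 0
      · simp [hi, hj]
      · simp [hi, hj, Ne.symm hj]
    · simp [hi]
  · intro m _ hm
    have hm' : (m : ℕ) ≠ k := fun e => hm (Fin.ext e)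
    rw [gapElement_truncShift_apply]
    simp [hm']
  · simp

theorem truncShift_pow_self (n : ℕ) : truncShift n ^ n = 0 := by
  ext i j
  have hi := i.2
  rw [truncShift_pow_apply, if_neg (by omega)]
  rfl

/-- The element `∑ₐ Tᵃ g g* T*ᵃ` with `g = (1 - T T*) T*ᵏ (1 - T* T)`. -/
def blockUnit {D : Type*} [Ring D] [StarRing D] (T : D) (k : ℕ) : D :=
  ∑ a ∈ Finset.range (k + 1), T ^ a * (gapElement T k * star (gapElement T k)) * star (T ^ a)

theorem map_blockUnit {D D' : Type*} [CStarAlgebra D] [CStarAlgebra D'] (φ : D →⋆ₐ[ℂ] D')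
    (T : D) (k : ℕ) : φ (blockUnit T k) = blockUnit (φ T) k := by
  simp [blockUnit, map_star, map_gapElement]

theorem blockUnit_truncShift_of_ne {n k : ℕ} (h : k + 1 ≠ n) : blockUnit (truncShift n) k = 0 := by
  simp [blockUnit, gapElement_truncShift_of_ne h]

theorem sum_pow_mul_one_sub_mul_star {D : Type*} [Ring D] [StarRing D] (T : D) (n : ℕ) :
    ∑ a ∈ Finset.range n, T ^ a * (1 - T * star T) * star (T ^ a) = 1 - T ^ n * star (T ^ n) := by
  induction n with
  | zero => simp
  | succ n ih =>
    rw [Finset.sum_range_succ, ih, pow_succ, star_mul]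
    noncomm_ring

/-- Here `g g* = 1 - T T*`, so the sum telescopes to `1 - T^{k+1} T*^{k+1}`, and `T` is nilpotent.
In `C*(⊕ S_n)` the element is thus the unit of the block `n = k + 1`. -/
theorem blockUnit_truncShift_self (k : ℕ) : blockUnit (truncShift (k + 1)) k = 1 := by
  rw [blockUnit, gapElement_truncShift_mul_star, sum_pow_mul_one_sub_mul_star,
    truncShift_pow_self, zero_mul, sub_zero]

theorem incl_gapElement_apply {X : Set ℕ+} (k : ℕ) (n : X) :
    CStarGen.incl _ (gapElement (CStarGen.gen (truncShiftSum X)) k) n =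
      gapElement (truncShift (n : ℕ+)) k := by
  have := map_gapElement ((matProdEval n).comp (CStarGen.incl (truncShiftSum X)))
    (CStarGen.gen (truncShiftSum X)) k
  exact this

theorem incl_blockUnit_apply {X : Set ℕ+} (k : ℕ) (n : X) :
    CStarGen.incl _ (blockUnit (CStarGen.gen (truncShiftSum X)) k) n =
      blockUnit (truncShift (n : ℕ+)) k := by
  have := map_blockUnit ((matProdEval n).comp (CStarGen.incl (truncShiftSum X)))
    (CStarGen.gen (truncShiftSum X)) k
  exact this

/-- A homomorphism on `C*(⊕ S_n)` which kills all blocks is dominated by the norms of the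
coordinates at infinity. -/
theorem norm_le_of_gap_eq_zero {X : Set ℕ+} [Infinite X] {B : Type*} [NonUnitalCStarAlgebra B]
    (π : CStarGen (truncShiftSum X) →⋆ₙₐ[ℂ] B)
    (hπ : ∀ n : X, π (gapElement (CStarGen.gen (truncShiftSum X)) (((n : ℕ+) : ℕ) - 1)) = 0)
    (x : CStarGen (truncShiftSum X)) (c : ℝ)
    (hc : ∀ᶠ n in cofinite, ‖CStarGen.incl _ x n‖ ≤ c) : ‖π x‖ ≤ c := by
  classical
  have hc0 : 0 ≤ c := by
    obtain ⟨n, hn⟩ := hc.exists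
    exact (norm_nonneg _).trans hn
  have hfin : {n | ¬ ‖CStarGen.incl _ x n‖ ≤ c}.Finite := hc
  -- `F` collects the exceptional coordinates, and `q` is the unit of their blocks. Since `q` lies
  -- in the ideal generated by the gap elements, `π x = π (x - q x)`, and the coordinates of `x - q
  -- x` in `F` vanish.
  let F : Finset X := hfin.toFinset
  let g := CStarGen.gen (truncShiftSum X)
  let q : CStarGen (truncShiftSum X) := ∑ n ∈ F, blockUnit g (((n : ℕ+) : ℕ) - 1)
  have hb : ∀ n : X, π (blockUnit g (((n : ℕ+) : ℕ) - 1) * x) = 0 := fun n => by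
    rw [blockUnit, Finset.sum_mul, map_sum]
    refine Finset.sum_eq_zero fun a _ => ?_
    rw [map_mul, map_mul, map_mul, map_mul π (gapElement _ _), hπ n]
    simp
  have hq : π (q * x) = 0 := by
    rw [Finset.sum_mul, map_sum]
    exact Finset.sum_eq_zero fun n _ => hb n
  have hx : π x = π (x - q * x) := by rw [map_sub, hq, sub_zero]
  rw [hx]
  refine (NonUnitalStarAlgHom.norm_apply_le π _).trans ?_
  rw [← NonUnitalStarAlgHom.norm_map (CStarGen.incl (truncShiftSum X))
    (CStarGen.incl_injective _)]
  refine lp.norm_le_of_forall_le hc0 fun m => ?_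
  have hqm : CStarGen.incl _ q m = if m ∈ F then 1 else 0 := by
    have h1 : CStarGen.incl _ q m = ∑ n ∈ F, blockUnit (truncShift (m : ℕ+)) ((n : ℕ+) - 1) := by
      have := map_sum ((matProdEval m).comp (CStarGen.incl (truncShiftSum X)))
        (fun n : X => blockUnit g (((n : ℕ+) : ℕ) - 1)) F
      refine this.trans (Finset.sum_congr rfl fun n _ => ?_)
      exact incl_blockUnit_apply _ m
    have h2 : ∀ n : X, n ≠ m → blockUnit (truncShift (m : ℕ+)) (((n : ℕ+) : ℕ) - 1) = 0 := by
      intro n hn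
      refine blockUnit_truncShift_of_ne fun e => hn ?_
      have := (n : ℕ+).pos
      exact Subtype.ext (PNat.eq (by omega))
    have h3 : blockUnit (truncShift (m : ℕ+)) (((m : ℕ+) : ℕ) - 1) = 1 := by
      have h := (m : ℕ+).pos
      generalize ((m : ℕ+) : ℕ) = j at h
      obtain ⟨k, rfl⟩ : ∃ k, j = k + 1 := ⟨j - 1, by omega⟩
      exact blockUnit_truncShift_self k
    rw [h1]
    split_ifs with hm
    · rw [Finset.sum_eq_single m (fun n _ hn => h2 n hn) (fun h => absurd hm h), h3]
    · exact Finset.sum_eq_zero fun n hn => h2 n fun e => hm (e ▸ hn)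
  have hsub : CStarGen.incl _ (x - q * x) m =
      CStarGen.incl _ x m - CStarGen.incl _ q m * CStarGen.incl _ x m := by
    have := ((matProdEval m).comp (CStarGen.incl (truncShiftSum X))).map_sub x (q * x)
    rw [map_mul] at this
    exact this
  rw [hsub, hqm]
  split_ifs with hm
  · rw [one_mul, sub_self, norm_zero]
    exact hc0
  · rw [zero_mul, sub_zero]
    simpa [F] using hm

end Gap

/-! ### The order relations between the covers -/

section Order

open Filter Topology Polynomial

/-- The cover `C*(⊕_{n ∈ X} S_n)`. -/
def truncCover (X : Set ℕ+) [Infinite X] : CStarCover.{0} discAlgebra :=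
  (isPolyCompletelyIsometric_truncShiftSum X).cover

/-- The cover `C*(S ⊕ S*)`. -/
def shiftCover : CStarCover.{0} discAlgebra := isPolyCompletelyIsometric_shiftSumAdjoint.cover

theorem isRFD_truncCover (X : Set ℕ+) [Infinite X] : IsRFD (truncCover X).alg :=
  ⟨X, Subtype.val, (CStarGen.incl (truncShiftSum X) : CStarGen (truncShiftSum X) →⋆ₙₐ[ℂ] MatProd X),
    CStarGen.incl_injective _⟩

theorem IsPolyCompletelyIsometric.cover_le_cover {D D' : Type u} [CStarAlgebra D] [CStarAlgebra D']
    {T : D} {T' : D'} (hT : IsPolyCompletelyIsometric T) (hT' : IsPolyCompletelyIsometric T')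
    (φ : CStarGen T →⋆ₐ[ℂ] CStarGen T') (h : φ (CStarGen.gen T) = CStarGen.gen T') :
    hT'.cover ≤ hT.cover := by
  let π : hT.cover.alg →⋆ₙₐ[ℂ] hT'.cover.alg := (φ : CStarGen T →⋆ₙₐ[ℂ] CStarGen T')
  refine ⟨π, CStarCover.eq_of_poly π fun p => ?_⟩
  rw [hT.cover_ι_poly, hT'.cover_ι_poly]
  exact starAlgHom_aeval_gen h p

theorem shiftCover_le_truncCover (X : Set ℕ+) [Infinite X] : shiftCover ≤ truncCover X := by
  obtain ⟨σ, hσ, -⟩ := exists_shiftHom X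
  exact IsPolyCompletelyIsometric.cover_le_cover _ _ σ hσ

theorem exists_genHom_of_map_eq {D D' : Type*} [CStarAlgebra D] [CStarAlgebra D'] {T : D} {T' : D'}
    (r : D →⋆ₐ[ℂ] D') (hr : r T = T') :
    ∃ φ : CStarGen T →⋆ₐ[ℂ] CStarGen T', φ (CStarGen.gen T) = CStarGen.gen T' := by
  subst hr
  have hc : Continuous r := AddMonoidHomClass.continuous_of_bound r 1 fun x => by
    simpa using NonUnitalStarAlgHom.norm_apply_le r x
  have hle : StarAlgebra.elemental ℂ T ≤ (StarAlgebra.elemental ℂ (r T)).comap r :=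
    StarAlgebra.elemental.le_of_mem ((StarAlgebra.elemental.isClosed ℂ (r T)).preimage hc)
      (StarAlgebra.elemental.self_mem ℂ (r T))
  let φ : CStarGen T →⋆ₐ[ℂ] CStarGen (r T) :=
    (r.comp (CStarGen.incl T)).codRestrict (StarAlgebra.elemental ℂ (r T)) fun x =>
      hle (Subtype.property x)
  exact ⟨φ, rfl⟩

/-- Restriction of families to a smaller index set. -/
def matProdRestrict {X Y : Set ℕ+} (h : Y ⊆ X) : MatProd X →⋆ₐ[ℂ] MatProd Y where
  toFun x := ⟨fun n => x ⟨n, h n.2⟩, memℓp_infty ⟨‖x‖, by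
    rintro _ ⟨n, rfl⟩
    exact lp.norm_apply_le_norm ENNReal.top_ne_zero x _⟩⟩
  map_one' := rfl
  map_mul' _ _ := rfl
  map_zero' := rfl
  map_add' _ _ := rfl
  commutes' _ := rfl
  map_star' _ := rfl

theorem truncCover_mono {X Y : Set ℕ+} [Infinite X] [Infinite Y] (h : Y ⊆ X) :
    truncCover Y ≤ truncCover X := by
  obtain ⟨φ, hφ⟩ := exists_genHom_of_map_eq (T := truncShiftSum X) (T' := truncShiftSum Y)
    (matProdRestrict h) rfl
  exact IsPolyCompletelyIsometric.cover_le_cover _ _ φ hφ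

theorem truncCover_gap_eq_zero {X : Set ℕ+} [Infinite X] {n : ℕ+} (hn : n ∉ X) :
    (truncCover X).gap (n - 1 : ℕ) = 0 := by
  suffices h0 : gapElement (CStarGen.gen (truncShiftSum X)) (n - 1 : ℕ) = 0 from
    (IsPolyCompletelyIsometric.cover_gap _ _).trans h0
  refine CStarGen.incl_injective _ ?_
  rw [map_zero]
  ext1
  funext m
  rw [incl_gapElement_apply]
  refine gapElement_truncShift_of_ne fun e => hn ?_
  have h := n.pos
  have : (m : ℕ+) = n := PNat.eq (by omega)
  exact this ▸ m.2

theorem truncCover_gap_ne_zero {X : Set ℕ+} [Infinite X] {n : ℕ+} (hn : n ∈ X) :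
    (truncCover X).gap (n - 1 : ℕ) ≠ 0 := by
  intro h0
  have h1 : gapElement (CStarGen.gen (truncShiftSum X)) (n - 1 : ℕ) = 0 :=
    (IsPolyCompletelyIsometric.cover_gap _ _).symm.trans h0
  have h2 := incl_gapElement_apply (X := X) (n - 1 : ℕ) ⟨n, hn⟩
  rw [h1, map_zero] at h2
  have h3 : gapElement (truncShift n) (n - 1 : ℕ) = 0 := h2.symm
  have h := n.pos
  generalize (n : ℕ) = j at h h3
  obtain ⟨k, rfl⟩ : ∃ k, j = k + 1 := ⟨j - 1, by omega⟩
  exact gapElement_truncShift_ne_zero k h3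

/-- Gap elements are built from the image of the disc algebra, so morphisms of covers preserve them.
-/
theorem CStarCover.gap_eq_zero_of_le {B C : CStarCover.{u} discAlgebra} (h : B ≤ C) {k : ℕ}
    (hk : C.gap k = 0) : B.gap k = 0 := by
  obtain ⟨π, hπ⟩ := h
  rw [← CStarCover.map_gap hπ, hk, map_zero]

/-- A cover below `C*(⊕_{n ∈ X} S_n)` which kills all blocks is below `C*(S ⊕ S*)`. -/
theorem le_shiftCover {X : Set ℕ+} [Infinite X] {K : CStarCover.{0} discAlgebra}
    (h : K ≤ truncCover X) (hK : ∀ n : ℕ+, K.gap (n - 1 : ℕ) = 0) : K ≤ shiftCover := by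
  obtain ⟨π, hπ⟩ := h
  let π' : CStarGen (truncShiftSum X) →⋆ₙₐ[ℂ] K.alg := π
  have hgap : ∀ n : X,
      π' (gapElement (CStarGen.gen (truncShiftSum X)) (((n : ℕ+) : ℕ) - 1)) = 0 := fun n => by
    have h1 := CStarCover.map_gap hπ (((n : ℕ+) : ℕ) - 1)
    rw [hK] at h1
    refine Eq.trans (congrArg π ?_) h1
    exact (IsPolyCompletelyIsometric.cover_gap _ _).symm
  obtain ⟨ψ, hψ⟩ := exists_factor_shiftHom X π' (norm_le_of_gap_eq_zero π' hgap)
  let ψ' : shiftCover.alg →⋆ₙₐ[ℂ] K.alg := ψ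
  refine ⟨ψ', CStarCover.eq_of_poly ψ' fun p => ?_⟩
  have h1 : shiftCover.ι (polyDisc p) = aeval (CStarGen.gen shiftSumAdjoint) p :=
    IsPolyCompletelyIsometric.cover_ι_poly _ p
  have h2 : (truncCover X).ι (polyDisc p) = aeval (CStarGen.gen (truncShiftSum X)) p :=
    IsPolyCompletelyIsometric.cover_ι_poly _ p
  have h3 := hπ (polyDisc p)
  rw [h2] at h3
  rw [h1]
  exact (hψ p).trans h3

end Order

/-! ### Failure of residual finite-dimensionality -/

section NotRFD

open Polynomial

/-- A *-homomorphism into a finite-dimensional algebra kills the defect projection `E = 1 - t t*`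
of an element `t` for which the elements `tᵇ E` are partial isometries with pairwise orthogonal
ranges. -/
theorem map_one_sub_mul_star_eq_zero {R M : Type*} [Ring R] [StarRing R] [Algebra ℂ R] [Ring M]
    [StarRing M] [Algebra ℂ M] [FiniteDimensional ℂ M] (ρ : R →⋆ₙₐ[ℂ] M) {t : R}
    (h1 : t * star t * t = t)
    (h2 : ∀ b : ℕ, star t * t ^ (b + 1) * (1 - t * star t) = t ^ b * (1 - t * star t)) :
    ρ (1 - t * star t) = 0 := by
  set e := 1 - t * star t with he
  have hee : e * e = e := by
    rw [he]
    have : t * star t * (t * star t) = t * star t := by rw [← mul_assoc, h1]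
    rw [sub_mul, mul_sub, mul_sub, this]
    simp
  have hes : star e = e := by simp [he]
  have het : e * t = 0 := by rw [he, sub_mul, one_mul, h1, sub_self]
  have hshift : ∀ a d : ℕ, star (t ^ a) * t ^ (a + d) * e = t ^ d * e := fun a d => by
    induction a with
    | zero => simp
    | succ a ih =>
      calc star (t ^ (a + 1)) * t ^ (a + 1 + d) * e
          = star (t ^ a) * (star t * t ^ (a + d + 1) * e) := by
            rw [pow_succ', star_mul, show a + 1 + d = a + d + 1 by ring]
            simp only [mul_assoc]
        _ = t ^ d * e := by rw [h2, ← mul_assoc, ih]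
  have horth : ∀ a d : ℕ, e * star (t ^ a) * (t ^ (a + (d + 1)) * e) = 0 := fun a d => by
    calc e * star (t ^ a) * (t ^ (a + (d + 1)) * e)
        = e * (star (t ^ a) * t ^ (a + (d + 1)) * e) := by simp only [mul_assoc]
      _ = 0 := by rw [hshift, pow_succ', ← mul_assoc, ← mul_assoc, het, zero_mul, zero_mul]
  have hself : ∀ a : ℕ, e * star (t ^ a) * (t ^ a * e) = e := fun a => by
    calc e * star (t ^ a) * (t ^ a * e) = e * (star (t ^ a) * t ^ (a + 0) * e) := by
          simp only [mul_assoc, add_zero]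
      _ = e := by rw [hshift, pow_zero, one_mul, hee]
  have horth' : ∀ a b : ℕ, a ≠ b → e * star (t ^ a) * (t ^ b * e) = 0 := fun a b hab => by
    rcases lt_or_gt_of_ne hab with h | h
    · obtain ⟨d, rfl⟩ := Nat.exists_eq_add_of_lt h
      exact horth a d
    · obtain ⟨d, rfl⟩ := Nat.exists_eq_add_of_lt h
      have := congrArg star (horth b d)
      rw [star_zero] at this
      rw [← this]
      simp [hes, mul_assoc, add_assoc]
  by_contra hne
  -- Left multiplication by `ρ (e t*ᵃ)` isolates the coefficient of index `a`, multiplied by `ρ e ≠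
  -- 0`. Infinitely many independent vectors contradict finite dimension.
  have hli : LinearIndependent ℂ fun b : ℕ => ρ (t ^ b * e) := by
    rw [linearIndependent_iff']
    intro s c hs a ha
    have h := congrArg (ρ (e * star (t ^ a)) * ·) hs
    simp only [Finset.mul_sum, mul_zero, mul_smul_comm, ← map_mul] at h
    rw [Finset.sum_eq_single a] at h
    · rw [hself] at h
      exact (smul_eq_zero.1 h).resolve_right hne
    · intro b _ hb
      rw [horth' a b hb.symm, map_zero, smul_zero]
    · exact fun h' => absurd ha h'
  exact (LinearIndependent.finite (R := ℂ) hli).false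

theorem backwardShift_unilateralShift (x : EllTwo) : backwardShift (unilateralShift x) = x := by
  ext i
  rw [backwardShift_apply, unilateralShift_apply]
  rfl

theorem EllTwoSum.ext {v w : EllTwoSum} (h1 : v.fst = w.fst) (h2 : v.snd = w.snd) : v = w :=
  WithLp.ofLp_injective 2 (Prod.ext h1 h2)

theorem shiftSumAdjoint_mul_star_mul :
    shiftSumAdjoint * star shiftSumAdjoint * shiftSumAdjoint = shiftSumAdjoint := by
  ext1 v
  change shiftSumAdjoint (star shiftSumAdjoint (shiftSumAdjoint v)) = _
  rw [star_shiftSumAdjoint_apply]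
  refine EllTwoSum.ext ?_ ?_
  · rw [shiftSumAdjoint_fst, shiftSumAdjoint_fst]
    exact congrArg unilateralShift (backwardShift_unilateralShift _)
  · rw [shiftSumAdjoint_snd, shiftSumAdjoint_snd]
    exact backwardShift_unilateralShift _

theorem one_sub_shift_mul_star_apply (v : EllTwoSum) :
    (1 - shiftSumAdjoint * star shiftSumAdjoint) v =
      WithLp.toLp 2 (v.fst - unilateralShift (backwardShift v.fst), 0) := by
  change v - shiftSumAdjoint (star shiftSumAdjoint v) = _
  rw [star_shiftSumAdjoint_apply]
  refine EllTwoSum.ext rfl ?_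
  change v.snd - backwardShift (unilateralShift v.snd) = 0
  rw [backwardShift_unilateralShift, sub_self]

/-- The defect projection maps into the first summand, which is invariant under `S ⊕ S*` and on
which that operator is an isometry. -/
theorem star_mul_shiftSumAdjoint_pow (b : ℕ) :
    star shiftSumAdjoint * shiftSumAdjoint ^ (b + 1) *
      (1 - shiftSumAdjoint * star shiftSumAdjoint) =
    shiftSumAdjoint ^ b * (1 - shiftSumAdjoint * star shiftSumAdjoint) := by
  have hsnd : ∀ v,
      ((shiftSumAdjoint ^ b * (1 - shiftSumAdjoint * star shiftSumAdjoint)) v).snd = 0 := by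
    intro v
    induction b with
    | zero =>
      rw [pow_zero, one_mul, one_sub_shift_mul_star_apply]
      rfl
    | succ b ih =>
      rw [pow_succ', mul_assoc, mul_apply_eq_comp, shiftSumAdjoint_snd, ih, map_zero]
  rw [pow_succ', ← mul_assoc, mul_assoc]
  set A := shiftSumAdjoint ^ b * (1 - shiftSumAdjoint * star shiftSumAdjoint)
  ext1 v
  change star shiftSumAdjoint (shiftSumAdjoint (A v)) = A v
  rw [star_shiftSumAdjoint_apply]
  refine EllTwoSum.ext (backwardShift_unilateralShift _) ?_
  change unilateralShift (shiftSumAdjoint (A v)).snd = (A v).snd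
  rw [shiftSumAdjoint_snd, hsnd, map_zero, map_zero]

theorem one_sub_shift_mul_star_ne_zero : 1 - shiftSumAdjoint * star shiftSumAdjoint ≠ 0 := by
  intro h
  have h1 := one_sub_shift_mul_star_apply (WithLp.toLp 2 (lp.single 2 0 1, 0))
  rw [h] at h1
  have h2 : (0 : EllTwo) = lp.single 2 0 1 - unilateralShift (backwardShift (lp.single 2 0 1)) :=
    congrArg WithLp.fst h1
  have h3 := congrArg (fun x : EllTwo => x 0) h2
  simp [unilateralShift_apply, shiftSeq] at h3

/-- The defect projection of the generator of `C*(S ⊕ S*)`. -/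
def shiftDefect : CStarGen shiftSumAdjoint :=
  1 - CStarGen.gen shiftSumAdjoint * star (CStarGen.gen shiftSumAdjoint)

theorem incl_shiftDefect :
    CStarGen.incl _ shiftDefect = 1 - shiftSumAdjoint * star shiftSumAdjoint := by
  simp [shiftDefect, map_star, CStarGen.incl_gen]

theorem shiftDefect_ne_zero : shiftDefect ≠ 0 := fun h =>
  one_sub_shift_mul_star_ne_zero (by rw [← incl_shiftDefect, h, map_zero])

theorem map_shiftDefect_eq_zero {r : ℕ}
    (ρ : CStarGen shiftSumAdjoint →⋆ₙₐ[ℂ] Matrix (Fin r) (Fin r) ℂ) : ρ shiftDefect = 0 := by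
  refine map_one_sub_mul_star_eq_zero ρ (CStarGen.incl_injective _ ?_)
    fun b => CStarGen.incl_injective _ ?_
  · simp only [map_mul, map_star, CStarGen.incl_gen]
    exact shiftSumAdjoint_mul_star_mul
  · simp only [map_mul, map_star, map_pow, map_sub, map_one, CStarGen.incl_gen]
    exact star_mul_shiftSumAdjoint_pow b

/-- Membership only provides an equivalent cover `B` that is RFD. The defect dies in `B`, since each
matrix coordinate gives a finite-dimensional representation of `C*(S ⊕ S*)`. But the round trip
through `B` fixes it, because it is expressed through the image of the disc algebra. -/
theorem shiftCover_notMem_rfdCovers : shiftCover.cls ∉ rfdCovers.{0} discAlgebra := by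
  rintro ⟨B, ⟨Λ, r, π, hπ⟩, hB⟩
  obtain ⟨⟨σ, hσ⟩, ⟨ρ, hρ⟩⟩ : shiftCover ≤ B ∧ B ≤ shiftCover := by
    have := Quotient.exact hB
    exact ⟨this.2, this.1⟩
  have hE : shiftDefect = shiftCover.ι (polyDisc 1) -
      shiftCover.ι (polyDisc X) * star (shiftCover.ι (polyDisc X)) := by
    have h : ∀ p, shiftCover.ι (polyDisc p) = aeval (CStarGen.gen shiftSumAdjoint) p :=
      IsPolyCompletelyIsometric.cover_ι_poly _
    rw [h, h, map_one, aeval_X]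
    rfl
  let ρ' : CStarGen shiftSumAdjoint →⋆ₙₐ[ℂ] B.alg := ρ
  let ev (l : Λ) : lp (fun l => Matrix (Fin (r l)) (Fin (r l)) ℂ) ∞ →⋆ₙₐ[ℂ]
      Matrix (Fin (r l)) (Fin (r l)) ℂ :=
    { toFun := fun x => x l
      map_smul' := fun _ _ => rfl
      map_zero' := rfl
      map_add' := fun _ _ => rfl
      map_mul' := fun _ _ => rfl
      map_star' := fun _ => rfl }
  have h0 : ρ' shiftDefect = 0 := by
    refine hπ ?_
    rw [map_zero]
    ext1
    funext l
    exact map_shiftDefect_eq_zero (((ev l).comp π).comp ρ')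
  have h1 : σ (ρ' shiftDefect) = shiftDefect := by
    rw [hE]
    change σ (ρ _) = _
    simp only [map_sub, map_mul, map_star, hρ, hσ]
  rw [h0, map_zero] at h1
  exact shiftDefect_ne_zero h1.symm

end NotRFD

/-! ### Meets -/

section Meets

theorem truncCover_mem_rfdCovers (X : Set ℕ+) [Infinite X] :
    (truncCover X).cls ∈ rfdCovers.{0} discAlgebra :=
  ⟨truncCover X, isRFD_truncCover X, rfl⟩

/-- If every `n` is missing from one of the sets `X j`, then `C*(S ⊕ S*)` is the meet of the covers
`C*(⊕_{n ∈ X j} S_n)`. -/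
theorem isGLB_truncCover {J : Type*} [Nonempty J] (X : J → Set ℕ+) [∀ j, Infinite (X j)]
    (hX : ∀ n, ∃ j, n ∉ X j) :
    IsGLB (Set.range fun j => (truncCover (X j)).cls) shiftCover.cls := by
  constructor
  · rintro _ ⟨j, rfl⟩
    exact shiftCover_le_truncCover (X j)
  · intro k hk
    induction k using Quotient.inductionOn with | _ K
    have hle : ∀ j, K ≤ truncCover (X j) := fun j => hk ⟨j, rfl⟩
    refine le_shiftCover (hle (Classical.arbitrary J)) fun n => ?_
    obtain ⟨j, hj⟩ := hX n
    exact CStarCover.gap_eq_zero_of_le (hle j) (truncCover_gap_eq_zero hj)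

/-- For `n ∈ X \ Y` the gap element of index `n - 1` vanishes in the smaller cover but not in the
larger one. -/
theorem truncCover_lt_truncCover {X Y : Set ℕ+} [Infinite X] [Infinite Y] (h : Y ⊂ X) :
    (truncCover Y).cls < (truncCover X).cls := by
  refine lt_of_le_not_ge (truncCover_mono h.subset) fun hge => ?_
  obtain ⟨n, hn, hnY⟩ := Set.exists_of_ssubset h
  have hle : truncCover X ≤ truncCover Y := hge
  exact truncCover_gap_ne_zero hn
    (CStarCover.gap_eq_zero_of_le hle (truncCover_gap_eq_zero hnY))

theorem infinite_pnat_of_forall_exists_ge {X : Set ℕ+} (h : ∀ m : ℕ+, ∃ n ∈ X, m < n) :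
    Infinite X :=
  Set.infinite_coe_iff.2 (Set.infinite_of_forall_exists_gt h)

instance infinite_even_pnat : Infinite {n : ℕ+ | Even (n : ℕ)} :=
  infinite_pnat_of_forall_exists_ge fun m => ⟨m + m, ⟨m, by simp⟩, by
    rw [← PNat.coe_lt_coe, PNat.add_coe]
    have := m.pos
    omega⟩

instance infinite_odd_pnat : Infinite {n : ℕ+ | Odd (n : ℕ)} :=
  infinite_pnat_of_forall_exists_ge fun m => ⟨m + m + 1, ⟨m, by simp; ring⟩, by
    rw [← PNat.coe_lt_coe, PNat.add_coe, PNat.add_coe, PNat.one_coe]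
    omega⟩

instance infinite_ge_pnat (k : ℕ+) : Infinite {n : ℕ+ | k ≤ n} :=
  infinite_pnat_of_forall_exists_ge fun m => ⟨m + k, (PNat.lt_add_left k m).le,
    PNat.lt_add_right m k⟩

theorem isGLB_even_odd :
    IsGLB {(truncCover {n | Even (n : ℕ)}).cls, (truncCover {n | Odd (n : ℕ)}).cls}
      shiftCover.cls := by
  let X : Bool → Set ℕ+ := fun b => if b then {n | Even (n : ℕ)} else {n | Odd (n : ℕ)}
  have hinf : ∀ b, Infinite (X b)
    | true => infinite_even_pnat
    | false => infinite_odd_pnat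
  have h := isGLB_truncCover X fun n => by
    rcases Nat.even_or_odd (n : ℕ) with h | h
    · exact ⟨false, fun h' : Odd (n : ℕ) => Nat.not_even_iff_odd.2 h' h⟩
    · exact ⟨true, fun h' : Even (n : ℕ) => Nat.not_odd_iff_even.2 h' h⟩
  rw [Bool.range_eq, Set.pair_comm] at h
  exact h

end Meets

theorem theorem4 :
    -- two RFD covers whose meet exists and is not RFD
    (∃ B C M : CStarCover.{0} discAlgebra,
      IsCoverOf B (truncShiftSum {n | Even (n : ℕ)}) ∧
      IsCoverOf C (truncShiftSum {n | Odd (n : ℕ)}) ∧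
      IsCoverOf M shiftSumAdjoint ∧
      B.cls ∈ rfdCovers discAlgebra ∧ C.cls ∈ rfdCovers discAlgebra ∧
      IsGLB {B.cls, C.cls} M.cls ∧ M.cls ∉ rfdCovers discAlgebra) ∧
    -- a strictly decreasing sequence of RFD covers whose meet exists and is not RFD
    (∃ (B : ℕ+ → CStarCover.{0} discAlgebra) (M : CStarCover.{0} discAlgebra),
      (∀ k, IsCoverOf (B k) (truncShiftSum {n | k ≤ n})) ∧
      StrictAnti (fun k => (B k).cls) ∧
      (∀ k, (B k).cls ∈ rfdCovers discAlgebra) ∧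
      IsGLB (Set.range fun k => (B k).cls) M.cls ∧ M.cls ∉ rfdCovers discAlgebra) ∧
    -- the RFD covers are not a sublattice of the lattice of covers
    ¬ IsSublatticeIn (rfdCovers.{0} discAlgebra) := by
  refine ⟨⟨truncCover _, truncCover _, shiftCover, IsPolyCompletelyIsometric.isCoverOf _,
      IsPolyCompletelyIsometric.isCoverOf _, IsPolyCompletelyIsometric.isCoverOf _,
      truncCover_mem_rfdCovers _, truncCover_mem_rfdCovers _, isGLB_even_odd,
      shiftCover_notMem_rfdCovers⟩,
    ⟨fun k => truncCover {n | k ≤ n}, shiftCover, fun k => IsPolyCompletelyIsometric.isCoverOf _,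
      fun k l hkl => truncCover_lt_truncCover ?_, fun k => truncCover_mem_rfdCovers _,
      -- The block `n` is missing from the tail that starts at `n + 1`.
      isGLB_truncCover _ fun n => ⟨n + 1, ?_⟩, shiftCover_notMem_rfdCovers⟩, fun h => ?_⟩
  · exact Set.Ici_ssubset_Ici.2 hkl
  · exact not_le.2 (PNat.lt_add_right n 1)
  · exact shiftCover_notMem_rfdCovers ((h _ (truncCover_mem_rfdCovers _) _
      (truncCover_mem_rfdCovers _)).1 _ isGLB_even_odd)

end
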